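/- Let $f,g:\mathbb R\to\mathbb R$ be of class $C^2$, $f$ even, $g$ odd, $F(x)=\int_0^x f$. Let $u_0$ be a non-constant $\tau_0$-periodic solution ($\tau_0>0$) of the Liénard equation $\ddot u+f(u)\dot u+g(u)=0$ with $u_0(0)=a$, $\dot u_0(0)=0$, and let $r$ be such that $u_0(t)^2+\dot u_0(t)^2<r^2$ for all $t$. Let $\gamma(s,u,v)$ be of class $C^2$ on $\mathbb R\times D$, $D=\{u^2+v^2<r^2\}$, and $1$-periodic in $s$. For real parameters $\varepsilon$ and $\tau>0$ consider the controllably periodic perturbation $$(L_R)\qquad \ddot u+f(u)\dot u+g(u)=\varepsilon\,\gamma\!\left(\tfrac t\tau,u,\dot u\right),$$ whose right-hand side has period $\tau$ in $t$. In the Liénard plane $x=(x_1,x_2)=(-\dot u-F(u),\,u)$ the unperturbed equation reads $\dot x_1=g(x_2)$, $\dot x_2=-x_1-F(x_2)$; let $p(t)=(-\dot u_0-F(u_0),u_0)$ be its periodic solution and $$\dot y=A(t)y,\qquad A(t)=\begin{pmatrix}0&g'(u_0(t))\\-1&-f(u_0(t))\end{pmatrix},$$ the variational system along it. (i) $1$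 is a simple characteristic multiplier of the variational system (a simple root of the characteristic polynomial of $Y(\tau_0)$, where $\dot Y=AY$, $Y(0)=I$) if and only if $\int_0^{\tau_0}f(u_0(t))\,dt\neq0$; in particular it is simple if $\int_0^{\tau_0}f(u_0(t))\,dt>0$. (ii) Suppose that $1$ is a simple characteristic multiplier. Let $c:\mathbb R\to\mathbb R$ be any $C^1$ function with $c(0)=0$, which prescribes the initial velocity (for example $c(k)=F(a)-F(a+k)$, which means starting at $p(0)+(0,k)$ in the Liénard plane, or $c\equiv0$). Then there are a constant $0<\tau_1<\tau_0/2$, an open neighbourhood $U$ of $(0,0)$ and continuous functions $\tau,h:U\to\mathbb R$ with $\tau(0,0)=\tau_0$, $h(0,0)=0$, such that for all $(\varepsilon,\phi)\in U$ one has $|\phi|<\tau_0/2$, $|\tau(\varepsilon,\phi)-\tau_0|<\tau_1$, and the solution of $(L_R)$ with $\tau=\tau(\varepsilon,\phi)$ and initial values $u(\phi)=a+h(\varepsilon,\phi)$, $\dot u(\phi)=c(h(\varepsilon,\phi))$ exists for all $t\in\mathbb R$, satisfies $u^2+\dot u^2<r^2$, and is $\tau(\varepsilon,\phi)$-periodic.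 (iii) Let $S=\{x: x_2^2+(-x_1-F(x_2))^2<r^2\}$ and let $\sigma$ be the Euclidean distance between the path of $p$ and the boundary of $S$. Then $\sigma>0$. Let $q_0$ be a bound of $|\gamma|$ on $\mathbb R\times D$ and $\Lambda$ a bound on $S$ of the Euclidean operator norm of the Jacobi matrix $\begin{pmatrix}0&g'(x_2)\\-1&-f(x_2)\end{pmatrix}$. If $\varepsilon,\phi,\tau\in\mathbb R$ and $k\in\mathbb R^2$ satisfy $|\phi|<\frac{\tau_0}2$, $|\tau-\tau_0|<\frac{\tau_0}2$ and $$\tfrac32\,\tau_0\,q_0\,|\varepsilon|+|k|<\sigma\,e^{-\frac32\Lambda\tau_0},$$ then $(L_R)$ has a solution on $[\phi,\phi+\tau]$ that starts at time $\phi$ at the point $p(0)+k$ of the Liénard plane and satisfies $u^2+\dot u^2<r^2$ there. -/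

import Mathlib

/-- The pair `(u, v)` solves `u' = v`, `v' = P(t, u, v) - f(u) v - g(u)` at every time of `I`, that is,
`u'' + f(u) u' + g(u) = P(t, u, u')` with `v = u'`. -/
def SolvesLienardOn (f g : ℝ → ℝ) (P : ℝ → ℝ → ℝ → ℝ) (u v : ℝ → ℝ) (I : Set ℝ) : Prop :=
  ∀ t ∈ I, HasDerivAt u (v t) t ∧
    HasDerivAt v (P t (u t) (v t) - f (u t) * v t - g (u t)) t

/-- The controllably periodic forcing `ε γ(t / τ, u, v)`. -/
noncomputable def controlledForcing (γ : ℝ → ℝ → ℝ → ℝ) (ε τ : ℝ) : ℝ → ℝ → ℝ → ℝ :=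
  fun t u v => ε * γ (t / τ) u v

/-- `F(x) = ∫₀ˣ f`. -/
noncomputable def primitiveF (f : ℝ → ℝ) (x : ℝ) : ℝ := ∫ s in (0 : ℝ)..x, f s

/-- The point `(-v - F(u), u)` of the Liénard plane that corresponds to position `u` and
velocity `v`. -/
noncomputable def lienardPoint (f : ℝ → ℝ) (u v : ℝ) : EuclideanSpace ℝ (Fin 2) :=
  !₂[-v - primitiveF f u, u]

/-- The region of the Liénard plane that corresponds to the disc `u² + v² < r²`. -/
def lienardRegion (f : ℝ → ℝ) (r : ℝ) : Set (EuclideanSpace ℝ (Fin 2)) :=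
  {x | (x 1) ^ 2 + (-(x 0) - primitiveF f (x 1)) ^ 2 < r ^ 2}

/-- The distance in the Liénard plane between the path of `(u₀, v₀)` and the boundary of the
region. -/
noncomputable def distToBoundary (f : ℝ → ℝ) (r : ℝ) (u₀ v₀ : ℝ → ℝ) : ℝ :=
  ⨅ t : ℝ, Metric.infDist (lienardPoint f (u₀ t) (v₀ t)) (frontier (lienardRegion f r))

/-- The Jacobi matrix, at a point with second coordinate `u`, of the Liénard vector field
`(x₁, x₂) ↦ (g(x₂), -x₁ - F(x₂))`. -/
noncomputable def lienardJacobian (f g : ℝ → ℝ) (u : ℝ) : Matrix (Fin 2) (Fin 2) ℝ :=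
  !![0, deriv g u; -1, -f u]

/-- `Y` is the fundamental matrix, normalized by `Y(0) = 1`, of the linear system `y' = A(t) y`. -/
def IsFundamentalMatrix (A Y : ℝ → Matrix (Fin 2) (Fin 2) ℝ) : Prop :=
  Y 0 = 1 ∧ ∀ t i j, HasDerivAt (fun s => Y s i j) ((A t * Y t) i j) t

/-- `ρ` is a simple characteristic multiplier of the `T`-periodic system `y' = A(t) y`: a simple
root of the characteristic polynomial of the monodromy matrix `Y(T)`. -/
def IsSimpleCharMultiplier (A : ℝ → Matrix (Fin 2) (Fin 2) ℝ) (T ρ : ℝ) : Prop :=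
  ∃ Y : ℝ → Matrix (Fin 2) (Fin 2) ℝ, IsFundamentalMatrix A Y ∧
    (Y T).charpoly.rootMultiplicity ρ = 1

/-!
The Liénard plane turns the equation into the first-order system `x' = X(x) - w e₁`, where
`X(x) = (g(x₂), -x₁ - F(x₂))` and `w` is the value of the forcing; the derivative of `X` is the
matrix of the variational system.

*Multipliers.* The velocity `p'` of the periodic orbit is a solution of the variational system, and
`p'(0) = (g(a), 0)` is not zero because a linear system has only the zero solution with zero initial
value. So the monodromy matrix is upper triangular with first diagonal entry `1`, and by Liouville's
formula the second one is `exp (-∫ f(u₀))`. Hence `1` is a simple root of the characteristic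
polynomial exactly when the integral is not zero (`isSimpleCharMultiplier_iff`).

*Periodic solutions.* In the rescaled time `s = (t - φ) / τ` the forcing has period `1` in `s` for
every choice of the parameters. The parameters `ε`, `φ`, `τ` are adjoined to the state as constants
(`extendedField`), and the field is changed away from the periodic orbit into a globally Lipschitz
one (`exists_lipschitz_extension_of_periodic`), so that its flow exists for all times. Its time-one
map is strictly differentiable, with the derivative given by the variational equation
(`hasStrictFDerivAt_flow`). The equation "displacement over one period = 0" is then solved for
`(τ, h)`: the derivative in these variables is `(dτ, dh) ↦ dτ p'(0) + dh (M - 1) ξ`, where `M` is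
the monodromy matrix and `ξ` the derivative of the initial point, with second coordinate `1`. Since
`p'(0)` is horizontal and the second coordinate of `(M - 1) ξ` is `M₂₂ - 1 ≠ 0`, this map is
invertible (`isInvertible_of_monodromy`).

*Explicit region.* A ball whose radius is the distance `σ` to the boundary, centred on the orbit,
lies in the region, and being convex it allows the mean value inequality with the constant `Λ`. As
long as the solution stays within `σ` of the orbit, Grönwall's inequality bounds its distance from
the orbit by `(‖k‖ + q₀ |ε| (t - φ)) exp (Λ (t - φ))`, and the smallness condition keeps this below
`σ` over a whole period (`exists_solution_of_perturbation_lt`).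
-/

section

open Set Metric Filter Topology
open scoped NNReal ContDiff Manifold

/-! ### Global existence for Lipschitz equations -/

/-- Two-sided form of Grönwall's inequality. -/
theorem norm_le_gronwallBound_abs_of_norm_deriv_le {E : Type*} [NormedAddCommGroup E]
    [NormedSpace ℝ E] {f f' : ℝ → E} {K ε t₀ T : ℝ}
    (hf : ∀ t ∈ Icc (t₀ - T) (t₀ + T), HasDerivAt f (f' t) t)
    (bound : ∀ t ∈ Icc (t₀ - T) (t₀ + T), ‖f' t‖ ≤ K * ‖f t‖ + ε) :
    ∀ t ∈ Icc (t₀ - T) (t₀ + T), ‖f t‖ ≤ gronwallBound ‖f t₀‖ K ε |t - t₀| := by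
  intro t ht
  rcases le_total t₀ t with h | h
  · rw [abs_of_nonneg (by linarith)]
    refine norm_le_gronwallBound_of_norm_deriv_right_le (f' := f') (b := t) ?_ ?_ le_rfl ?_ t
      ⟨h, le_rfl⟩
    · exact fun s hs => (hf s ⟨by linarith [hs.1, ht.1, ht.2], by linarith [hs.2, ht.2]⟩)
        |>.continuousAt.continuousWithinAt
    · exact fun s hs => (hf s ⟨by linarith [hs.1, ht.2], by linarith [hs.2, ht.2]⟩).hasDerivWithinAt
    · exact fun s hs => bound s ⟨by linarith [hs.1, ht.2], by linarith [hs.2, ht.2]⟩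
  · rw [abs_of_nonpos (by linarith), show -(t - t₀) = (2 * t₀ - t) - t₀ by ring]
    have hd : ∀ s ∈ Icc t₀ (2 * t₀ - t),
        HasDerivAt (fun s => f (2 * t₀ - s)) (-f' (2 * t₀ - s)) s := by
      intro s hs
      have h1 : HasDerivAt (fun s : ℝ => 2 * t₀ - s) (-1) s := by
        simpa using (hasDerivAt_id s).const_sub (2 * t₀)
      have := (hf (2 * t₀ - s) ⟨by linarith [hs.2, ht.1], by linarith [hs.1, ht.1]⟩).scomp s h1
      simpa [Function.comp_def] using this
    have key := norm_le_gronwallBound_of_norm_deriv_right_le (f := fun s => f (2 * t₀ - s))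
      (f' := fun s => -f' (2 * t₀ - s)) (K := K) (ε := ε) (δ := ‖f t₀‖) (a := t₀) (b := 2 * t₀ - t)
      (fun s hs => (hd s hs).continuousAt.continuousWithinAt)
      (fun s hs => (hd s (Ico_subset_Icc_self hs)).hasDerivWithinAt)
      (by rw [show 2 * t₀ - t₀ = t₀ by ring])
      (fun s hs => by
        rw [norm_neg]
        exact bound _ ⟨by linarith [hs.2, ht.1], by linarith [hs.1, ht.1]⟩)
      (2 * t₀ - t) ⟨by linarith, le_rfl⟩
    simpa using key

/-- A truncation of the identity of a finite-dimensional space: Lipschitz, bounded, equal to the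
identity on a given ball, and never increasing the norm. -/
theorem exists_lipschitz_truncation (E : Type*) [NormedAddCommGroup E] [NormedSpace ℝ E]
    [FiniteDimensional ℝ E] (R : ℝ) :
    ∃ (C : ℝ≥0) (B : ℝ) (ρ : E → E), LipschitzWith C ρ ∧ (∀ x, ‖ρ x‖ ≤ B) ∧
      (∀ x, ‖ρ x‖ ≤ ‖x‖) ∧ ∀ x, ‖x‖ ≤ R → ρ x = x := by
  let b : ContDiffBump (0 : E) :=
    ⟨max R 1, max R 1 + 1, by positivity, by linarith⟩
  have hs : HasCompactSupport (fun x => b x • x) := b.hasCompactSupport.smul_right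
  have hc : ContDiff ℝ 1 (fun x => b x • x) := b.contDiff.smul contDiff_id
  obtain ⟨C, hC⟩ := hc.lipschitzWith_of_hasCompactSupport hs one_ne_zero
  obtain ⟨B, hB⟩ := hs.exists_bound_of_continuous hc.continuous
  refine ⟨C, B, _, hC, hB, fun x => ?_, fun x hx => ?_⟩
  · rw [norm_smul, Real.norm_of_nonneg b.nonneg]
    exact mul_le_of_le_one_left (norm_nonneg _) b.le_one
  · have : b x = 1 := b.one_of_mem_closedBall (by
      simpa [b] using Or.inl hx)
    simp [this]

section GlobalExistence

variable {E : Type*} [NormedAddCommGroup E] [NormedSpace ℝ E] [FiniteDimensional ℝ E]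
  {V : ℝ → E → E} {K : ℝ≥0}

/-- The truncated field is bounded, so the Picard–Lindelöf theorem applies to it on the whole
interval; by Grönwall's inequality the truncation is never felt. -/
theorem exists_hasDerivAt_Ioo_of_lipschitz (hV : ∀ t, LipschitzWith K (V t))
    (hc : ∀ x, Continuous fun t => V t x) (t₀ : ℝ) (x₀ : E) {T : ℝ} (hT : 0 < T) :
    ∃ α : ℝ → E, α t₀ = x₀ ∧ ∀ t ∈ Ioo (t₀ - T) (t₀ + T), HasDerivAt α (V t (α t)) t := by
  obtain ⟨M, hM⟩ := (isCompact_Icc (a := t₀ - T) (b := t₀ + T)).exists_bound_of_continuousOn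
    (hc 0).continuousOn
  have hM0 : 0 ≤ M := (norm_nonneg _).trans (hM t₀ ⟨by linarith, by linarith⟩)
  have hlin : ∀ t ∈ Icc (t₀ - T) (t₀ + T), ∀ y, ‖V t y‖ ≤ K * ‖y‖ + M := by
    intro t ht y
    have h1 := (hV t).norm_sub_le y 0
    rw [sub_zero] at h1
    have h2 := norm_sub_norm_le (V t y) (V t 0)
    linarith [hM t ht]
  obtain ⟨C, B, ρ, hρL, hρB, hρn, hρid⟩ := exists_lipschitz_truncation E (gronwallBound ‖x₀‖ K M T)
  have hB0 : 0 ≤ B := (norm_nonneg _).trans (hρB 0)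
  have hPL : IsPicardLindelof (fun t y => V t (ρ y)) (tmin := t₀ - T) (tmax := t₀ + T)
      ⟨t₀, by linarith, by linarith⟩ x₀ (⟨(K * B + M) * T, by positivity⟩) 0
      ⟨K * B + M, by positivity⟩ (K * C) := by
    refine ⟨fun t _ => ((hV t).comp hρL).lipschitzOnWith, fun x _ => (hc _).continuousOn,
      fun t ht x _ => ?_, ?_⟩
    · exact (hlin t ht _).trans (by
        change _ ≤ K * B + M
        gcongr; exact hρB x)
    · simp only [add_sub_cancel_left, sub_sub_cancel, max_self, NNReal.coe_zero, sub_zero]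
      exact le_rfl
  obtain ⟨α, hα0, hα⟩ := hPL.exists_eq_forall_mem_Icc_hasDerivWithinAt₀
  have hα' : ∀ t ∈ Ioo (t₀ - T) (t₀ + T), HasDerivAt α (V t (ρ (α t))) t := fun t ht =>
    (hα t (Ioo_subset_Icc_self ht)).hasDerivAt (Icc_mem_nhds ht.1 ht.2)
  refine ⟨α, hα0, fun t ht => ?_⟩
  have hb : ‖α t‖ ≤ gronwallBound ‖x₀‖ K M T := by
    have hlt : |t - t₀| < T := abs_lt.2 ⟨by linarith [ht.1], by linarith [ht.2]⟩
    have hsub : ∀ s ∈ Icc (t₀ - |t - t₀|) (t₀ + |t - t₀|), s ∈ Ioo (t₀ - T) (t₀ + T) :=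
      fun s hs => ⟨by linarith [hs.1], by linarith [hs.2]⟩
    have := norm_le_gronwallBound_abs_of_norm_deriv_le (f := α) (K := K) (ε := M)
      (fun s hs => hα' s (hsub s hs)) (fun s hs =>
        (hlin s (Ioo_subset_Icc_self (hsub s hs)) _).trans (by gcongr; exact hρn _)) t
        ⟨by linarith [neg_abs_le (t - t₀)], by linarith [le_abs_self (t - t₀)]⟩
    simp only at hα0
    rw [hα0] at this
    exact this.trans (gronwallBound_mono (norm_nonneg _) hM0 K.2 hlt.le)
  have := hα' t ht
  rwa [hρid _ hb] at this

/-- A globally Lipschitz vector field, continuous in time, has solutions defined for all times. -/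
theorem exists_forall_hasDerivAt_of_lipschitz (hV : ∀ t, LipschitzWith K (V t))
    (hc : ∀ x, Continuous fun t => V t x) (t₀ : ℝ) (x₀ : E) :
    ∃ α : ℝ → E, α t₀ = x₀ ∧ ∀ t, HasDerivAt α (V t (α t)) t := by
  choose α hα0 hα using fun n : ℕ => exists_hasDerivAt_Ioo_of_lipschitz hV hc t₀ x₀
    (T := (n : ℝ) + 1) (by positivity)
  have hagree : ∀ m n : ℕ, m ≤ n →
      EqOn (α m) (α n) (Ioo (t₀ - ((m : ℝ) + 1)) (t₀ + ((m : ℝ) + 1))) := by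
    intro m n hmn
    have hmn' : (m : ℝ) ≤ n := by exact_mod_cast hmn
    have hm : (0 : ℝ) ≤ m := by positivity
    exact ODE_solution_unique_of_mem_Ioo (s := fun _ => univ) (K := K)
      (fun t _ => (hV t).lipschitzOnWith) (t₀ := t₀) ⟨by linarith, by linarith⟩
      (fun t ht => ⟨hα m t ht, trivial⟩)
      (fun t ht => ⟨hα n t ⟨by linarith [ht.1], by linarith [ht.2]⟩, trivial⟩)
      (by rw [hα0, hα0])
  refine ⟨fun t => α ⌈|t - t₀|⌉₊ t, by simp [hα0], fun t => ?_⟩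
  have key : ∀ n : ℕ, ∀ s, |s - t₀| < (n : ℝ) + 1 → α ⌈|s - t₀|⌉₊ s = α n s := by
    intro n s hs
    have hs' := abs_lt.1 hs
    have h1 := Nat.le_ceil |s - t₀|
    have h2 := neg_abs_le (s - t₀)
    have h3 := le_abs_self (s - t₀)
    rcases le_total ⌈|s - t₀|⌉₊ n with h | h
    · exact hagree _ _ h ⟨by linarith, by linarith⟩
    · exact (hagree _ _ h ⟨by linarith, by linarith⟩).symm
  set n := ⌈|t - t₀|⌉₊ with hn
  have hlt : |t - t₀| < (n : ℝ) + 1 := (Nat.le_ceil _).trans_lt (lt_add_one _)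
  have hev : (fun s => α ⌈|s - t₀|⌉₊ s) =ᶠ[𝓝 t] α n := by
    have : ∀ᶠ s in 𝓝 t, |s - t₀| < (n : ℝ) + 1 :=
      (by fun_prop : ContinuousAt (fun s => |s - t₀|) t).eventually_lt_const hlt
    exact this.mono fun s hs => key n s hs
  have hlt' := abs_lt.1 hlt
  exact (hα n t ⟨by linarith, by linarith⟩).congr_of_eventuallyEq hev

end GlobalExistence

/-! ### Differentiability of the flow -/

section SmoothDependence

variable {E : Type*} [NormedAddCommGroup E] [NormedSpace ℝ E]

theorem ContDiff.differentiable_slice {V : ℝ → E → E}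
    (hV : ContDiff ℝ 1 (fun p : ℝ × E => V p.1 p.2)) (t : ℝ) : Differentiable ℝ (V t) :=
  (hV.comp (contDiff_const.prodMk contDiff_id : ContDiff ℝ 1 fun x : E => (t, x))).differentiable
    one_ne_zero

theorem ContDiff.continuous_fderiv_slice {V : ℝ → E → E}
    (hV : ContDiff ℝ 1 (fun p : ℝ × E => V p.1 p.2)) :
    Continuous fun p : ℝ × E => fderiv ℝ (V p.1) p.2 :=
  (ContDiff.fderiv (n := 0) (m := 1) (f := fun p : ℝ × E => V p.1)
    (hV.comp (by fun_prop : ContDiff ℝ 1 fun q : (ℝ × E) × E => (q.1.1, q.2)))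
    contDiff_snd (by norm_num)).continuous

/-- A periodic time-dependent `C¹` field on an open set `Ω` can be changed away from a given compact
subset so that it becomes a globally Lipschitz periodic `C¹` field on the whole space. -/
theorem exists_lipschitz_extension_of_periodic [FiniteDimensional ℝ E] {W : ℝ → E → E}
    {Ω Q : Set E} {T : ℝ} (hT : 0 < T)
    (hΩ : IsOpen Ω) (hW : ContDiffOn ℝ 1 (fun p : ℝ × E => W p.1 p.2) (univ ×ˢ Ω))
    (hper : ∀ t, ∀ x ∈ Ω, W (t + T) x = W t x) (hQ : IsCompact Q) (hQΩ : Q ⊆ Ω) :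
    ∃ (V : ℝ → E → E) (K : ℝ≥0) (O : Set E), ContDiff ℝ 1 (fun p : ℝ × E => V p.1 p.2) ∧
      (∀ t, LipschitzWith K (V t)) ∧ (∀ t x, V (t + T) x = V t x) ∧
      IsOpen O ∧ Q ⊆ O ∧ O ⊆ Ω ∧ ∀ t, ∀ x ∈ O, V t x = W t x := by
  obtain ⟨Q₁, hQ₁, hQQ₁, hQ₁Ω⟩ := exists_compact_between hQ hΩ hQΩ
  obtain ⟨χ, hχ1, hχ0, -⟩ := exists_contMDiffMap_one_nhds_of_subset_interior (n := 1) 𝓘(ℝ, E)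
    hQ.isClosed hQQ₁
  obtain ⟨O, hO, hQO, hOχ⟩ := mem_nhdsSet_iff_exists.1 hχ1
  have hχc : ContDiff ℝ 1 χ := χ.contMDiff.contDiff
  let V : ℝ → E → E := fun t x => χ x • W t x
  have hzero : ∀ t, ∀ x ∉ Q₁, V t x = 0 := fun t x hx => by simp [V, hχ0 x hx]
  have hV : ContDiff ℝ 1 (fun p : ℝ × E => V p.1 p.2) := by
    rw [contDiff_iff_contDiffAt]
    rintro ⟨t, x⟩
    by_cases hx : x ∈ Q₁
    · have h1 : ContDiffAt ℝ 1 (fun p : ℝ × E => W p.1 p.2) (t, x) :=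
        hW.contDiffAt ((isOpen_univ.prod hΩ).mem_nhds ⟨trivial, hQ₁Ω hx⟩)
      exact (hχc.comp contDiff_snd).contDiffAt.smul h1
    · refine (contDiffAt_const (c := (0 : E))).congr_of_eventuallyEq ?_
      have : ∀ᶠ p : ℝ × E in 𝓝 (t, x), p.2 ∈ Q₁ᶜ :=
        continuousAt_snd.eventually (hQ₁.isClosed.isOpen_compl.mem_nhds hx)
      exact this.mono fun p hp => hzero p.1 p.2 hp
  have hVper : ∀ t x, V (t + T) x = V t x := by
    intro t x
    by_cases hx : x ∈ Q₁
    · simp [V, hper t x (hQ₁Ω hx)]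
    · rw [hzero _ _ hx, hzero _ _ hx]
  have hdiff : ∀ t, Differentiable ℝ (V t) := hV.differentiable_slice
  have hcont := hV.continuous_fderiv_slice
  obtain ⟨M, hM⟩ := ((isCompact_Icc (a := (0 : ℝ)) (b := T)).prod hQ₁).exists_bound_of_continuousOn
    hcont.continuousOn
  have hbound : ∀ t x, ‖fderiv ℝ (V t) x‖ ≤ max M 0 := by
    intro t x
    obtain ⟨s, hs, hst⟩ := Function.Periodic.exists_mem_Ico₀
      (f := fun t => V t) (c := T) (fun t => funext (hVper t)) hT t
    rw [show V t = V s from hst]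
    by_cases hx : x ∈ Q₁
    · exact (hM (s, x) ⟨Ico_subset_Icc_self hs, hx⟩).trans (le_max_left _ _)
    · have : V s =ᶠ[𝓝 x] fun _ => (0 : E) :=
        Filter.mem_of_superset (hQ₁.isClosed.isOpen_compl.mem_nhds hx) fun y hy => hzero s y hy
      rw [this.fderiv_eq]
      simp
  refine ⟨V, ⟨max M 0, le_max_right _ _⟩, O ∩ Ω, hV, fun t => ?_, hVper, hO.inter hΩ,
    subset_inter hQO hQΩ, inter_subset_right, fun t x hx => ?_⟩
  · exact lipschitzWith_of_nnnorm_fderiv_le (hdiff t) fun x => hbound t x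
  · have : χ x = 1 := hOχ hx.1
    simp [V, this]

/-- Two solutions of a globally Lipschitz equation separate at most exponentially. -/
theorem norm_sub_le_of_lipschitz {V : ℝ → E → E} {K : ℝ≥0} (hV : ∀ t, LipschitzWith K (V t))
    {y z : ℝ → E} (hy : ∀ t, HasDerivAt y (V t (y t)) t) (hz : ∀ t, HasDerivAt z (V t (z t)) t)
    {t : ℝ} (ht : 0 ≤ t) : ‖y t - z t‖ ≤ ‖y 0 - z 0‖ * Real.exp (K * t) := by
  have := dist_le_of_trajectories_ODE (a := 0) (b := t) hV
    (fun s _ => (hy s).continuousAt.continuousWithinAt) (fun s _ => (hy s).hasDerivWithinAt)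
    (fun s _ => (hz s).continuousAt.continuousWithinAt) (fun s _ => (hz s).hasDerivWithinAt)
    le_rfl t ⟨ht, le_rfl⟩
  simpa [dist_eq_norm] using this

/-- Along a compact piece of a curve, a field that is `C¹` is strictly differentiable in the space
variable uniformly in time. -/
theorem exists_forall_norm_sub_sub_fderiv_le {V : ℝ → E → E}
    (hV : ContDiff ℝ 1 (fun p : ℝ × E => V p.1 p.2)) {z : ℝ → E} (hz : Continuous z) (T : ℝ)
    {c : ℝ} (hc : 0 < c) :
    ∃ δ > 0, ∀ t ∈ Icc 0 T, ∀ x ∈ ball (z t) δ, ∀ y ∈ ball (z t) δ,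
      ‖V t x - V t y - fderiv ℝ (V t) (z t) (x - y)‖ ≤ c * ‖x - y‖ := by
  have hcont : Continuous fun p : ℝ × E => fderiv ℝ (V p.1) (z p.1 + p.2) :=
    hV.continuous_fderiv_slice.comp
      (by fun_prop : Continuous fun p : ℝ × E => (p.1, z p.1 + p.2))
  have hdiff : ∀ t, Differentiable ℝ (V t) := hV.differentiable_slice
  have hev : ∀ᶠ e : E in 𝓝 0, ∀ t ∈ Icc (0 : ℝ) T,
      ‖fderiv ℝ (V t) (z t + e) - fderiv ℝ (V t) (z t)‖ < c := by
    have hset : IsOpen {p : E × ℝ |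
        ‖fderiv ℝ (V p.2) (z p.2 + p.1) - fderiv ℝ (V p.2) (z p.2)‖ < c} := by
      refine isOpen_lt (Continuous.norm (Continuous.sub ?_ ?_)) continuous_const
      · exact hcont.comp (continuous_snd.prodMk continuous_fst)
      · simpa [Function.comp_def] using hcont.comp
          (continuous_snd.prodMk (continuous_const (y := (0 : E))) :
            Continuous fun p : E × ℝ => (p.2, (0 : E)))
    refine isCompact_Icc.eventually_forall_of_forall_eventually fun t _ => ?_
    exact hset.mem_nhds (by simpa using hc)
  obtain ⟨δ, hδ, h⟩ := Metric.eventually_nhds_iff_ball.1 hev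
  refine ⟨δ, hδ, fun t ht x hx y hy => ?_⟩
  refine (convex_ball (z t) δ).norm_image_sub_le_of_norm_fderiv_le' (𝕜 := ℝ)
    (fun x _ => hdiff t x) (fun w hw => ?_) hy hx
  have := h (w - z t) (by simpa [dist_eq_norm] using hw) t ht
  rw [add_sub_cancel] at this
  exact this.le

/-- **Differentiability of the flow**: the time-`T` map of a `C¹`, globally Lipschitz equation is
strictly differentiable, with derivative the solution `L` of the variational equation. -/
theorem hasStrictFDerivAt_flow {V : ℝ → E → E} {K : ℝ≥0}
    (hV : ContDiff ℝ 1 (fun p : ℝ × E => V p.1 p.2)) (hL : ∀ t, LipschitzWith K (V t))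
    {z : E → ℝ → E} (hz0 : ∀ x, z x 0 = x) (hz : ∀ x t, HasDerivAt (z x) (V t (z x t)) t)
    (x₀ : E) {L : ℝ → E →L[ℝ] E} (hL0 : L 0 = ContinuousLinearMap.id ℝ E)
    (hL' : ∀ t, HasDerivAt L ((fderiv ℝ (V t) (z x₀ t)).comp (L t)) t) {T : ℝ} (hT : 0 ≤ T) :
    HasStrictFDerivAt (fun x => z x T) (L T) x₀ := by
  have hzc : Continuous (z x₀) := continuous_iff_continuousAt.2 fun t => (hz x₀ t).continuousAt
  have hB : ∀ t x, ‖fderiv ℝ (V t) x‖ ≤ K := fun t x => norm_fderiv_le_of_lipschitz ℝ (hL t)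
  rw [hasStrictFDerivAt_iff_isLittleO, Asymptotics.isLittleO_iff]
  intro ε hε
  set G := gronwallBound 0 K (Real.exp (K * T)) T with hG
  have hG0 : 0 ≤ G := by
    have := gronwallBound_mono (δ := 0) (K := K) (ε := Real.exp (K * T)) le_rfl
      (Real.exp_nonneg _) K.2 hT
    rwa [gronwallBound_x0] at this
  obtain ⟨δ, hδ, hunif⟩ := exists_forall_norm_sub_sub_fderiv_le hV hzc T
    (c := ε / (G + 1)) (by positivity)
  have hclose : ∀ x ∈ ball x₀ (δ * Real.exp (-(K * T))),
      ∀ t ∈ Icc 0 T, z x t ∈ ball (z x₀ t) δ := by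
    intro x hx t ht
    rw [mem_ball, dist_eq_norm] at hx ⊢
    calc ‖z x t - z x₀ t‖ ≤ ‖x - x₀‖ * Real.exp (K * t) := by
          simpa [hz0] using norm_sub_le_of_lipschitz hL (hz x) (hz x₀) ht.1
      _ ≤ ‖x - x₀‖ * Real.exp (K * T) := by gcongr; exact ht.2
      _ < δ * Real.exp (-(K * T)) * Real.exp (K * T) := by gcongr
      _ = δ := by rw [mul_assoc, ← Real.exp_add]; simp
  have hball : ball x₀ (δ * Real.exp (-(K * T))) ∈ 𝓝 x₀ := ball_mem_nhds _ (by positivity)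
  filter_upwards [prod_mem_nhds hball hball] with p hp
  obtain ⟨x, y⟩ := p
  have hx := hclose x hp.1
  have hy := hclose y hp.2
  set N := ‖x - y‖ with hN
  have hd : ∀ t, HasDerivAt (fun t => z x t - z y t - L t (x - y))
      (V t (z x t) - V t (z y t) - fderiv ℝ (V t) (z x₀ t) (L t (x - y))) t := fun t =>
    ((hz x t).sub (hz y t)).sub ((hL' t).clm_apply (hasDerivAt_const t (x - y)) |>.congr_deriv
      (by simp))
  have key := norm_le_gronwallBound_of_norm_deriv_right_le
    (K := K) (ε := ε / (G + 1) * (N * Real.exp (K * T))) (δ := 0) (a := 0) (b := T)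
    (fun t _ => (hd t).continuousAt.continuousWithinAt) (fun t _ => (hd t).hasDerivWithinAt)
    (by simp [hz0, hL0]) (fun t ht => by
      have h1 := hunif t (Ico_subset_Icc_self ht) _ (hx t (Ico_subset_Icc_self ht)) _
        (hy t (Ico_subset_Icc_self ht))
      have h2 : ‖z x t - z y t‖ ≤ N * Real.exp (K * T) := by
        refine (norm_sub_le_of_lipschitz hL (hz x) (hz y) ht.1).trans ?_
        rw [hz0, hz0]
        gcongr
        exact ht.2.le
      have h3 : V t (z x t) - V t (z y t) - fderiv ℝ (V t) (z x₀ t) (L t (x - y))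
          = (V t (z x t) - V t (z y t) - fderiv ℝ (V t) (z x₀ t) (z x t - z y t))
            + fderiv ℝ (V t) (z x₀ t) (z x t - z y t - L t (x - y)) := by
        rw [map_sub _ (z x t - z y t)]; abel
      rw [h3]
      refine (norm_add_le _ _).trans ?_
      rw [add_comm]
      gcongr
      · exact (ContinuousLinearMap.le_opNorm _ _).trans (by gcongr; exact hB _ _)
      · exact h1.trans (by gcongr)) T ⟨hT, le_rfl⟩
  have hscale : gronwallBound 0 K (ε / (G + 1) * (N * Real.exp (K * T))) (T - 0)
      = ε / (G + 1) * N * G := by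
    rw [hG, sub_zero]
    unfold gronwallBound
    split_ifs <;> ring
  rw [hscale] at key
  refine key.trans ?_
  have : G / (G + 1) ≤ 1 := (div_le_one (by positivity)).2 (by linarith)
  calc ε / (G + 1) * N * G = ε * N * (G / (G + 1)) := by ring
    _ ≤ ε * N * 1 := by gcongr
    _ = ε * ‖(x, y).1 - (x, y).2‖ := by simp [hN]

end SmoothDependence

/-! ### Linear systems and the Liénard plane -/

section LinearSystems

variable {E : Type*} [NormedAddCommGroup E] [NormedSpace ℝ E] {B : ℝ → E →L[ℝ] E} {K : ℝ≥0}

theorem lipschitzWith_clm_of_norm_le (hB : ∀ t, ‖B t‖ ≤ K) (t : ℝ) : LipschitzWith K (B t) :=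
  (B t).lipschitz.weaken (hB t)

theorem linear_solution_unique (hB : ∀ t, ‖B t‖ ≤ K) {y z : ℝ → E}
    (hy : ∀ t, HasDerivAt y (B t (y t)) t) (hz : ∀ t, HasDerivAt z (B t (z t)) t)
    (h0 : y 0 = z 0) : y = z :=
  ODE_solution_unique_univ (v := fun t x => B t x) (s := fun _ => univ) (K := K) (t₀ := 0)
    (fun t => (lipschitzWith_clm_of_norm_le hB t).lipschitzOnWith)
    (fun t => ⟨hy t, trivial⟩) (fun t => ⟨hz t, trivial⟩) h0

variable [FiniteDimensional ℝ E]

theorem exists_linear_solution (hB : ∀ t, ‖B t‖ ≤ K) (hBc : Continuous B) (x₀ : E) :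
    ∃ y : ℝ → E, y 0 = x₀ ∧ ∀ t, HasDerivAt y (B t (y t)) t :=
  exists_forall_hasDerivAt_of_lipschitz (V := fun t x => B t x)
    (lipschitzWith_clm_of_norm_le hB) (fun x => by fun_prop) 0 x₀

/-- The fundamental solution of a linear system with bounded continuous coefficients. -/
theorem exists_fundamental_solution (hB : ∀ t, ‖B t‖ ≤ K) (hBc : Continuous B) :
    ∃ L : ℝ → E →L[ℝ] E, L 0 = ContinuousLinearMap.id ℝ E ∧
      ∀ t, HasDerivAt L ((B t).comp (L t)) t := by
  refine exists_linear_solution (E := E →L[ℝ] E) (K := K)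
    (B := fun t => ContinuousLinearMap.compL ℝ E E E (B t)) (fun t => ?_) (by fun_prop) _
  refine ContinuousLinearMap.opNorm_le_bound _ K.2 fun M => ?_
  exact (ContinuousLinearMap.opNorm_comp_le _ _).trans (by gcongr; exact hB t)

end LinearSystems

section LienardPlane

variable {f g : ℝ → ℝ}

theorem hasDerivAt_primitiveF (hf : Continuous f) (x : ℝ) : HasDerivAt (primitiveF f) (f x) x :=
  intervalIntegral.integral_hasDerivAt_right (hf.intervalIntegrable _ _)
    (hf.stronglyMeasurableAtFilter _ _) hf.continuousAt

theorem contDiff_primitiveF (hf : Continuous f) : ContDiff ℝ 1 (primitiveF f) := by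
  rw [contDiff_one_iff_deriv]
  refine ⟨fun x => (hasDerivAt_primitiveF hf x).differentiableAt, ?_⟩
  rwa [show deriv (primitiveF f) = f from funext fun x => (hasDerivAt_primitiveF hf x).deriv]

/-- The velocity `u' = -x₁ - F(x₂)` at a point of the Liénard plane. -/
noncomputable def lienardVelocity (f : ℝ → ℝ) (x : EuclideanSpace ℝ (Fin 2)) : ℝ :=
  -(x 0) - primitiveF f (x 1)

/-- The vector field of the equation `u'' + f(u) u' + g(u) = w` in the Liénard plane, where `w` is
the value of the forcing. -/
noncomputable def lienardField (f g : ℝ → ℝ) (w : ℝ) (x : EuclideanSpace ℝ (Fin 2)) :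
    EuclideanSpace ℝ (Fin 2) :=
  !₂[g (x 1) - w, lienardVelocity f x]

theorem contDiff_lienardVelocity (hf : Continuous f) : ContDiff ℝ 1 (lienardVelocity f) := by
  have := contDiff_primitiveF hf
  unfold lienardVelocity
  fun_prop

theorem lienardPoint_velocity (x : EuclideanSpace ℝ (Fin 2)) :
    lienardPoint f (x 1) (lienardVelocity f x) = x := by
  ext i
  fin_cases i <;> simp [lienardPoint, lienardVelocity]

@[simp] theorem lienardPoint_zero (u v : ℝ) : lienardPoint f u v 0 = -v - primitiveF f u := rfl

@[simp] theorem lienardPoint_one (u v : ℝ) : lienardPoint f u v 1 = u := rfl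

@[simp] theorem lienardVelocity_lienardPoint (u v : ℝ) :
    lienardVelocity f (lienardPoint f u v) = v := by
  simp [lienardVelocity]

theorem mem_lienardRegion {r : ℝ} {x : EuclideanSpace ℝ (Fin 2)} :
    x ∈ lienardRegion f r ↔ x 1 ^ 2 + lienardVelocity f x ^ 2 < r ^ 2 := Iff.rfl

theorem isOpen_lienardRegion (hf : Continuous f) (r : ℝ) : IsOpen (lienardRegion f r) := by
  have := (contDiff_lienardVelocity hf).continuous
  exact isOpen_lt (by fun_prop : Continuous fun x : EuclideanSpace ℝ (Fin 2) =>
    x 1 ^ 2 + lienardVelocity f x ^ 2) continuous_const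

theorem hasDerivAt_euclidean_fin_two {x : ℝ → EuclideanSpace ℝ (Fin 2)}
    {x' : EuclideanSpace ℝ (Fin 2)} {t : ℝ} :
    HasDerivAt x x' t ↔
      HasDerivAt (fun s => x s 0) (x' 0) t ∧ HasDerivAt (fun s => x s 1) (x' 1) t := by
  have h : ∀ i, (PiLp.proj 2 (fun _ : Fin 2 => ℝ) i ∘L ContinuousLinearMap.toSpanSingleton ℝ x')
      = ContinuousLinearMap.toSpanSingleton ℝ (x' i) := fun i => by ext; simp
  rw [hasDerivAt_iff_hasFDerivAt, ← hasFDerivWithinAt_univ, hasFDerivWithinAt_euclidean,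
    Fin.forall_fin_two, h, h, hasFDerivWithinAt_univ, hasFDerivWithinAt_univ]
  rfl

/-- A solution of the second-order equation gives a solution of the Liénard system. -/
theorem SolvesLienardOn.hasDerivAt_lienardPoint {P : ℝ → ℝ → ℝ → ℝ} {u v : ℝ → ℝ} {I : Set ℝ}
    (hf : Continuous f) (h : SolvesLienardOn f g P u v I) {t : ℝ} (ht : t ∈ I) :
    HasDerivAt (fun t => lienardPoint f (u t) (v t))
      (lienardField f g (P t (u t) (v t)) (lienardPoint f (u t) (v t))) t := by
  obtain ⟨hu, hv⟩ := h t ht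
  rw [hasDerivAt_euclidean_fin_two]
  constructor
  · refine (hv.neg.sub ((hasDerivAt_primitiveF hf (u t)).comp t hu)).congr_deriv ?_
    simp [lienardField]
    ring
  · refine hu.congr_deriv ?_
    simp [lienardField]

/-- A solution of the Liénard system gives a solution of the second-order equation. -/
theorem solvesLienardOn_of_hasDerivAt {P : ℝ → ℝ → ℝ → ℝ} {x : ℝ → EuclideanSpace ℝ (Fin 2)}
    {I : Set ℝ} (hf : Continuous f)
    (h : ∀ t ∈ I, HasDerivAt x (lienardField f g (P t (x t 1) (lienardVelocity f (x t))) (x t)) t) :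
    SolvesLienardOn f g P (fun t => x t 1) (fun t => lienardVelocity f (x t)) I := by
  intro t ht
  obtain ⟨h0, h1⟩ := hasDerivAt_euclidean_fin_two.1 (h t ht)
  have h2 : HasDerivAt (fun t => lienardVelocity f (x t)) _ t :=
    h0.neg.sub (HasDerivAt.comp (h₂ := primitiveF f) t (hasDerivAt_primitiveF hf (x t 1)) h1)
  refine ⟨h1, h2.congr_deriv ?_⟩
  simp [lienardField]
  ring

theorem toEuclideanCLM_lienardJacobian_apply (u : ℝ) (y : EuclideanSpace ℝ (Fin 2)) :
    Matrix.toEuclideanCLM (𝕜 := ℝ) (lienardJacobian f g u) y =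
      !₂[deriv g u * y 1, -y 0 - f u * y 1] := by
  ext i
  rw [Matrix.ofLp_toEuclideanCLM]
  fin_cases i <;> simp [lienardJacobian, Matrix.mulVec, dotProduct, Fin.sum_univ_two]; ring

/-- The derivative of the Liénard field is the Liénard Jacobi matrix. -/
theorem hasFDerivAt_lienardField (hf : Continuous f) (hg : ContDiff ℝ 1 g) (w : ℝ)
    (x : EuclideanSpace ℝ (Fin 2)) :
    HasFDerivAt (lienardField f g w)
      (Matrix.toEuclideanCLM (𝕜 := ℝ) (lienardJacobian f g (x 1))) x := by
  have hp : ∀ i, HasFDerivAt (fun x : EuclideanSpace ℝ (Fin 2) => x i)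
      (EuclideanSpace.proj (𝕜 := ℝ) i : EuclideanSpace ℝ (Fin 2) →L[ℝ] ℝ) x := fun i =>
    (EuclideanSpace.proj (𝕜 := ℝ) i : EuclideanSpace ℝ (Fin 2) →L[ℝ] ℝ).hasFDerivAt
  rw [← hasFDerivWithinAt_univ, hasFDerivWithinAt_euclidean, Fin.forall_fin_two,
    hasFDerivWithinAt_univ, hasFDerivWithinAt_univ]
  constructor
  · have hg1 :=
      ((hg.differentiable one_ne_zero (x 1)).hasDerivAt.comp_hasFDerivAt x (hp 1)).sub_const w
    refine hg1.congr_fderiv ?_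
    ext y
    simp [toEuclideanCLM_lienardJacobian_apply]
  · have h1 := (hp 0).neg.sub ((hasDerivAt_primitiveF hf (x 1)).comp_hasFDerivAt x (hp 1))
    refine h1.congr_fderiv ?_
    ext y
    simp [toEuclideanCLM_lienardJacobian_apply]

theorem contDiff_lienardField (hf : Continuous f) (hg : ContDiff ℝ 1 g) :
    ContDiff ℝ 1 (fun p : ℝ × EuclideanSpace ℝ (Fin 2) => lienardField f g p.1 p.2) := by
  have hv := contDiff_lienardVelocity hf
  rw [contDiff_euclidean, Fin.forall_fin_two]
  constructor
  · change ContDiff ℝ 1 fun p : ℝ × EuclideanSpace ℝ (Fin 2) => g (p.2 1) - p.1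
    fun_prop
  · change ContDiff ℝ 1 fun p : ℝ × EuclideanSpace ℝ (Fin 2) => lienardVelocity f p.2
    fun_prop

end LienardPlane

section PeriodicOrbit

variable {f g : ℝ → ℝ} {u₀ v₀ : ℝ → ℝ} {τ₀ : ℝ}

theorem SolvesLienardOn.periodic_velocity {P : ℝ → ℝ → ℝ → ℝ}
    (h : SolvesLienardOn f g P u₀ v₀ univ) (hper : Function.Periodic u₀ τ₀) :
    Function.Periodic v₀ τ₀ := by
  intro t
  have h1 : HasDerivAt u₀ (v₀ (t + τ₀)) t := by
    have := (h (t + τ₀) trivial).1.comp_add_const t τ₀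
    rwa [show (fun x => u₀ (x + τ₀)) = u₀ from funext hper] at this
  exact h1.unique (h t trivial).1

theorem SolvesLienardOn.continuous_position {P : ℝ → ℝ → ℝ → ℝ}
    (h : SolvesLienardOn f g P u₀ v₀ univ) : Continuous u₀ :=
  continuous_iff_continuousAt.2 fun t => (h t trivial).1.continuousAt

/-- The coefficient `A(t)` of the variational system, as a continuous linear map. -/
noncomputable def variationalCLM (f g u₀ : ℝ → ℝ) (t : ℝ) :
    EuclideanSpace ℝ (Fin 2) →L[ℝ] EuclideanSpace ℝ (Fin 2) :=
  Matrix.toEuclideanCLM (𝕜 := ℝ) (lienardJacobian f g (u₀ t))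

theorem continuous_variationalCLM (hf : Continuous f) (hg : ContDiff ℝ 1 g) (hu : Continuous u₀) :
    Continuous (variationalCLM f g u₀) := by
  have h1 : Continuous fun M : Matrix (Fin 2) (Fin 2) ℝ => Matrix.toEuclideanCLM (𝕜 := ℝ) M :=
    LinearMap.continuous_of_finiteDimensional
      ((Matrix.toEuclideanCLM (n := Fin 2) (𝕜 := ℝ)).toAlgEquiv.toLinearMap)
  refine h1.comp (continuous_matrix fun i j => ?_)
  have := hg.continuous_deriv le_rfl
  fin_cases i <;> fin_cases j <;> simp [lienardJacobian] <;> fun_prop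

theorem exists_norm_variationalCLM_le (hf : Continuous f) (hg : ContDiff ℝ 1 g) (hu : Continuous u₀)
    (hτ₀ : 0 < τ₀) (hper : Function.Periodic u₀ τ₀) :
    ∃ K : ℝ≥0, ∀ t, ‖variationalCLM f g u₀ t‖ ≤ K := by
  obtain ⟨M, hM⟩ := (isCompact_Icc (a := (0 : ℝ)) (b := τ₀)).exists_bound_of_continuousOn
    (continuous_variationalCLM hf hg hu).continuousOn
  refine ⟨⟨max M 0, le_max_right _ _⟩, fun t => ?_⟩
  obtain ⟨s, hs, hst⟩ := hper.exists_mem_Ico₀ hτ₀ t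
  unfold variationalCLM at hM ⊢
  rw [hst]
  exact (hM s (Ico_subset_Icc_self hs)).trans (le_max_left _ _)

/-- The velocity `p'` of the periodic solution solves the variational system. -/
theorem SolvesLienardOn.hasDerivAt_lienardField (hf : Continuous f) (hg : ContDiff ℝ 1 g)
    (h : SolvesLienardOn f g (fun _ _ _ => 0) u₀ v₀ univ) (t : ℝ) :
    HasDerivAt (fun t => lienardField f g 0 (lienardPoint f (u₀ t) (v₀ t)))
      (variationalCLM f g u₀ t (lienardField f g 0 (lienardPoint f (u₀ t) (v₀ t)))) t :=
  HasFDerivAt.comp_hasDerivAt (l := lienardField f g 0) t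
    (hasFDerivAt_lienardField hf hg 0 (lienardPoint f (u₀ t) (v₀ t)))
    (h.hasDerivAt_lienardPoint hf trivial)

/-- Along a nonconstant periodic solution with `u₀'(0) = 0` the force does not vanish at time `0`:
otherwise `p'` would be the zero solution of the variational system. -/
theorem SolvesLienardOn.force_ne_zero (hf : Continuous f) (hg : ContDiff ℝ 1 g)
    (h : SolvesLienardOn f g (fun _ _ _ => 0) u₀ v₀ univ) (hτ₀ : 0 < τ₀)
    (hper : Function.Periodic u₀ τ₀) (hnonconst : ∃ t, u₀ t ≠ u₀ 0) (hv0 : v₀ 0 = 0) :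
    g (u₀ 0) ≠ 0 := by
  intro hg0
  obtain ⟨K, hK⟩ := exists_norm_variationalCLM_le hf hg h.continuous_position hτ₀ hper
  have hz := linear_solution_unique hK (h.hasDerivAt_lienardField hf hg) (z := fun _ => 0)
    (fun t => by simpa using hasDerivAt_const t (0 : EuclideanSpace ℝ (Fin 2)))
    (by ext i; fin_cases i <;> simp [lienardField, hg0, hv0])
  have hv : ∀ t, v₀ t = 0 := fun t => by
    have := congrArg (fun y : EuclideanSpace ℝ (Fin 2) => y 1) (congrFun hz t)
    simpa [lienardField] using this
  obtain ⟨t, ht⟩ := hnonconst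
  refine ht (is_const_of_deriv_eq_zero (fun s => (h s trivial).1.differentiableAt)
    (fun s => ?_) t 0)
  rw [(h s trivial).1.deriv, hv]

end PeriodicOrbit

/-! ### The characteristic multipliers of the variational system -/

section CharacteristicMultiplier

variable {f g : ℝ → ℝ} {u₀ v₀ : ℝ → ℝ} {τ₀ : ℝ}

theorem isFundamentalMatrix_column {Y : ℝ → Matrix (Fin 2) (Fin 2) ℝ}
    (hY : IsFundamentalMatrix (fun t => lienardJacobian f g (u₀ t)) Y)
    (k : EuclideanSpace ℝ (Fin 2)) (t : ℝ) :
    HasDerivAt (fun t => Matrix.toEuclideanCLM (𝕜 := ℝ) (Y t) k)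
      (variationalCLM f g u₀ t (Matrix.toEuclideanCLM (𝕜 := ℝ) (Y t) k)) t := by
  have h := hY.2 t
  have hc : ∀ i, (fun t => Matrix.toEuclideanCLM (𝕜 := ℝ) (Y t) k i) =
      fun t => Y t i 0 * k 0 + Y t i 1 * k 1 := fun i => by
    funext t
    rw [Matrix.ofLp_toEuclideanCLM]
    simp [Matrix.mulVec, dotProduct, Fin.sum_univ_two]
  have hv : variationalCLM f g u₀ t (Matrix.toEuclideanCLM (𝕜 := ℝ) (Y t) k) =
      Matrix.toEuclideanCLM (𝕜 := ℝ) (lienardJacobian f g (u₀ t) * Y t) k := by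
    rw [map_mul]
    rfl
  rw [hasDerivAt_euclidean_fin_two, hv, hc, hc, Matrix.ofLp_toEuclideanCLM]
  constructor
  · refine (((h 0 0).mul_const (k 0)).add ((h 0 1).mul_const (k 1))).congr_deriv ?_
    simp [Matrix.mulVec, dotProduct, Fin.sum_univ_two]
  · refine (((h 1 0).mul_const (k 0)).add ((h 1 1).mul_const (k 1))).congr_deriv ?_
    simp [Matrix.mulVec, dotProduct, Fin.sum_univ_two]

theorem exists_isFundamentalMatrix (hf : Continuous f) (hg : ContDiff ℝ 1 g) (hu : Continuous u₀)
    (hτ₀ : 0 < τ₀) (hper : Function.Periodic u₀ τ₀) :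
    ∃ Y, IsFundamentalMatrix (fun t => lienardJacobian f g (u₀ t)) Y := by
  obtain ⟨K, hK⟩ := exists_norm_variationalCLM_le hf hg hu hτ₀ hper
  choose y hy0 hy using fun j : Fin 2 =>
    exists_linear_solution hK (continuous_variationalCLM hf hg hu) (EuclideanSpace.single j (1 : ℝ))
  refine ⟨fun t => Matrix.of fun i j => y j t i, ?_, fun t i j => ?_⟩
  · ext i j
    simp [hy0, Matrix.one_apply]
  · have h := hasDerivAt_euclidean_fin_two.1 (hy j t)
    rw [variationalCLM, Matrix.ofLp_toEuclideanCLM] at h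
    fin_cases i
    · refine h.1.congr_deriv ?_
      simp [Matrix.mulVec, dotProduct, Matrix.mul_apply]
    · refine h.2.congr_deriv ?_
      simp [Matrix.mulVec, dotProduct, Matrix.mul_apply]

/-- **Liouville's formula** for the variational system, whose coefficient has trace `-f(u₀)`. -/
theorem det_fundamentalMatrix (hf : Continuous f) (hu : Continuous u₀)
    {Y : ℝ → Matrix (Fin 2) (Fin 2) ℝ}
    (hY : IsFundamentalMatrix (fun t => lienardJacobian f g (u₀ t)) Y) (T : ℝ) :
    (Y T).det = Real.exp (-∫ t in (0 : ℝ)..T, f (u₀ t)) := by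
  have hI : ∀ t, HasDerivAt (fun T => ∫ s in (0 : ℝ)..T, f (u₀ s)) (f (u₀ t)) t := fun t =>
    hasDerivAt_primitiveF (hf.comp hu) t
  have hD : ∀ t, HasDerivAt (fun t => (Y t).det * Real.exp (∫ s in (0 : ℝ)..t, f (u₀ s))) 0 t := by
    intro t
    have h := hY.2 t
    simp only [Matrix.det_fin_two]
    refine ((((h 0 0).mul (h 1 1)).sub ((h 0 1).mul (h 1 0))).mul (hI t).exp).congr_deriv ?_
    simp [Matrix.mul_apply, Fin.sum_univ_two, lienardJacobian]
    ring
  have hc := is_const_of_deriv_eq_zero (fun t => (hD t).differentiableAt)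
    (fun t => (hD t).deriv) T 0
  simp only [hY.1, Matrix.det_one, intervalIntegral.integral_same, Real.exp_zero, mul_one] at hc
  rw [Real.exp_neg]
  exact eq_inv_of_mul_eq_one_left hc

/-- The monodromy matrix fixes `p'(0)`, a nonzero multiple of the first basis vector, so it is upper
triangular with diagonal entries `1` and `exp(-∫ f(u₀))`. -/
theorem monodromy_entries (hf : Continuous f) (hg : ContDiff ℝ 1 g)
    (h : SolvesLienardOn f g (fun _ _ _ => 0) u₀ v₀ univ) (hτ₀ : 0 < τ₀)
    (hper : Function.Periodic u₀ τ₀) (hnonconst : ∃ t, u₀ t ≠ u₀ 0) (hv0 : v₀ 0 = 0)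
    {Y : ℝ → Matrix (Fin 2) (Fin 2) ℝ}
    (hY : IsFundamentalMatrix (fun t => lienardJacobian f g (u₀ t)) Y) :
    Y τ₀ 0 0 = 1 ∧ Y τ₀ 1 0 = 0 ∧ Y τ₀ 1 1 = Real.exp (-∫ t in (0 : ℝ)..τ₀, f (u₀ t)) := by
  have hg0 := h.force_ne_zero hf hg hτ₀ hper hnonconst hv0
  obtain ⟨K, hK⟩ := exists_norm_variationalCLM_le hf hg h.continuous_position hτ₀ hper
  have hvper : v₀ τ₀ = v₀ 0 := by simpa using h.periodic_velocity hper 0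
  have huper : u₀ τ₀ = u₀ 0 := by simpa using hper 0
  have heq := congrFun (linear_solution_unique hK (isFundamentalMatrix_column hY
    (lienardField f g 0 (lienardPoint f (u₀ 0) (v₀ 0)))) (h.hasDerivAt_lienardField hf hg)
    (by simp [hY.1])) τ₀
  simp only [huper, hvper] at heq
  have h0 := congrArg (fun y : EuclideanSpace ℝ (Fin 2) => y 0) heq
  have h1 := congrArg (fun y : EuclideanSpace ℝ (Fin 2) => y 1) heq
  simp only [Matrix.ofLp_toEuclideanCLM] at h0 h1
  simp [Matrix.mulVec, dotProduct, Fin.sum_univ_two, lienardField, hv0, hg0] at h0 h1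
  have hdet := det_fundamentalMatrix hf h.continuous_position hY τ₀
  rw [Matrix.det_fin_two, h0, h1] at hdet
  exact ⟨h0, h1, by simpa using hdet⟩

theorem isSimpleCharMultiplier_iff (hf : Continuous f) (hg : ContDiff ℝ 1 g)
    (h : SolvesLienardOn f g (fun _ _ _ => 0) u₀ v₀ univ) (hτ₀ : 0 < τ₀)
    (hper : Function.Periodic u₀ τ₀) (hnonconst : ∃ t, u₀ t ≠ u₀ 0) (hv0 : v₀ 0 = 0) :
    IsSimpleCharMultiplier (fun t => lienardJacobian f g (u₀ t)) τ₀ 1 ↔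
      (∫ t in (0 : ℝ)..τ₀, f (u₀ t)) ≠ 0 := by
  have key : ∀ Y, IsFundamentalMatrix (fun t => lienardJacobian f g (u₀ t)) Y →
      ((Y τ₀).charpoly.rootMultiplicity 1 = 1 ↔ (∫ t in (0 : ℝ)..τ₀, f (u₀ t)) ≠ 0) := by
    intro Y hY
    obtain ⟨h00, h10, h11⟩ := monodromy_entries hf hg h hτ₀ hper hnonconst hv0 hY
    have hchar : (Y τ₀).charpoly = (Polynomial.X - Polynomial.C 1) *
        (Polynomial.X - Polynomial.C (Y τ₀ 1 1)) := by
      simp [Matrix.charpoly, Matrix.det_fin_two, Matrix.charmatrix, h00, h10]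
    rw [hchar, Polynomial.rootMultiplicity_mul (mul_ne_zero (Polynomial.X_sub_C_ne_zero _)
      (Polynomial.X_sub_C_ne_zero _)), Polynomial.rootMultiplicity_X_sub_C,
      Polynomial.rootMultiplicity_X_sub_C, h11]
    simp only [if_true, add_eq_left, ite_eq_right_iff,
      one_ne_zero, imp_false, ne_eq]
    rw [eq_comm, Real.exp_eq_one_iff, neg_eq_zero]
  constructor
  · rintro ⟨Y, hY, hm⟩
    exact (key Y hY).1 hm
  · intro hne
    obtain ⟨Y, hY⟩ := exists_isFundamentalMatrix hf hg h.continuous_position hτ₀ hper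
    exact ⟨Y, hY, (key Y hY).2 hne⟩

end CharacteristicMultiplier

/-! ### The region and the a priori estimate -/

section Region

variable {f g : ℝ → ℝ} {u₀ v₀ : ℝ → ℝ} {τ₀ r : ℝ}

theorem lienardRegion_ne_univ : lienardRegion f r ≠ univ := fun h => by
  have : lienardPoint f r 0 ∈ lienardRegion f r := h ▸ mem_univ _
  simp [mem_lienardRegion] at this

theorem ball_infDist_frontier_subset {S : Set (EuclideanSpace ℝ (Fin 2))}
    {x : EuclideanSpace ℝ (Fin 2)} (hx : x ∈ S) (hS : S ≠ univ) :
    ball x (infDist x (frontier S)) ⊆ S := by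
  obtain ⟨y, hy, hxy⟩ := exists_mem_frontier_infDist_compl_eq_dist hx hS
  exact (ball_subset_ball ((infDist_le_dist_of_mem hy).trans hxy.ge)).trans
    ball_infDist_compl_subset

theorem distToBoundary_le (t : ℝ) : distToBoundary f r u₀ v₀ ≤
    infDist (lienardPoint f (u₀ t) (v₀ t)) (frontier (lienardRegion f r)) :=
  ciInf_le ⟨0, by rintro _ ⟨t, rfl⟩; exact infDist_nonneg⟩ t

theorem lienardPoint_mem_lienardRegion {u v : ℝ} (h : u ^ 2 + v ^ 2 < r ^ 2) :
    lienardPoint f u v ∈ lienardRegion f r := by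
  simpa [mem_lienardRegion] using h

theorem ball_distToBoundary_subset (horbit : ∀ t, u₀ t ^ 2 + v₀ t ^ 2 < r ^ 2) (t : ℝ) :
    ball (lienardPoint f (u₀ t) (v₀ t)) (distToBoundary f r u₀ v₀) ⊆ lienardRegion f r :=
  (ball_subset_ball (distToBoundary_le t)).trans
    (ball_infDist_frontier_subset (lienardPoint_mem_lienardRegion (horbit t)) lienardRegion_ne_univ)

theorem SolvesLienardOn.continuous_lienardPoint {P : ℝ → ℝ → ℝ → ℝ} (hf : Continuous f)
    (h : SolvesLienardOn f g P u₀ v₀ univ) :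
    Continuous fun t => lienardPoint f (u₀ t) (v₀ t) :=
  continuous_iff_continuousAt.2 fun _ => (h.hasDerivAt_lienardPoint hf trivial).continuousAt

theorem SolvesLienardOn.periodic_lienardPoint {P : ℝ → ℝ → ℝ → ℝ}
    (h : SolvesLienardOn f g P u₀ v₀ univ) (hper : Function.Periodic u₀ τ₀) :
    Function.Periodic (fun t => lienardPoint f (u₀ t) (v₀ t)) τ₀ := fun t => by
  simp only [hper t, h.periodic_velocity hper t]

theorem isCompact_range_lienardPoint {P : ℝ → ℝ → ℝ → ℝ} (hf : Continuous f)
    (h : SolvesLienardOn f g P u₀ v₀ univ) (hτ₀ : 0 < τ₀) (hper : Function.Periodic u₀ τ₀) :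
    IsCompact (range fun t => lienardPoint f (u₀ t) (v₀ t)) := by
  rw [← (h.periodic_lienardPoint hper).image_Icc hτ₀ 0]
  exact isCompact_Icc.image (h.continuous_lienardPoint hf)

theorem distToBoundary_pos {P : ℝ → ℝ → ℝ → ℝ} (hf : Continuous f)
    (h : SolvesLienardOn f g P u₀ v₀ univ) (hτ₀ : 0 < τ₀) (hper : Function.Periodic u₀ τ₀)
    (horbit : ∀ t, u₀ t ^ 2 + v₀ t ^ 2 < r ^ 2) : 0 < distToBoundary f r u₀ v₀ := by
  have hmem : ∀ t, lienardPoint f (u₀ t) (v₀ t) ∈ lienardRegion f r := fun t =>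
    lienardPoint_mem_lienardRegion (horbit t)
  have hne : (frontier (lienardRegion f r)).Nonempty :=
    nonempty_frontier_iff.2 ⟨⟨_, hmem 0⟩, lienardRegion_ne_univ⟩
  obtain ⟨_, ⟨t₁, rfl⟩, ht₁⟩ := (isCompact_range_lienardPoint hf h hτ₀ hper).exists_isMinOn
    (range_nonempty _) (continuous_infDist_pt (frontier (lienardRegion f r))).continuousOn
  refine lt_of_lt_of_le ?_ (le_ciInf fun t => ht₁ (mem_range_self t))
  refine (isClosed_frontier.notMem_iff_infDist_pos hne).1 fun hfr => ?_
  exact disjoint_left.1 (disjoint_frontier_iff_isOpen.2 (isOpen_lienardRegion hf r)) hfr (hmem t₁)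

end Region

section APriori

variable {f g : ℝ → ℝ} {u₀ v₀ : ℝ → ℝ} {τ₀ r : ℝ} {γ : ℝ → ℝ → ℝ → ℝ}

theorem contDiffOn_forcing (hf : Continuous f)
    (hγ : ContDiffOn ℝ 2 (fun p : ℝ × ℝ × ℝ => γ p.1 p.2.1 p.2.2)
      (univ ×ˢ {w : ℝ × ℝ | w.1 ^ 2 + w.2 ^ 2 < r ^ 2})) :
    ContDiffOn ℝ 1 (fun p : ℝ × EuclideanSpace ℝ (Fin 2) => γ p.1 (p.2 1) (lienardVelocity f p.2))
      (univ ×ˢ lienardRegion f r) := by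
  have hv := contDiff_lienardVelocity hf
  exact (hγ.of_le one_le_two).comp (s := univ ×ˢ lienardRegion f r)
    (f := fun p : ℝ × EuclideanSpace ℝ (Fin 2) => (p.1, p.2 1, lienardVelocity f p.2))
    (by fun_prop : ContDiff ℝ 1 _).contDiffOn fun p hp => ⟨trivial, hp.2⟩

theorem gronwallBound_le {δ K ε x : ℝ} (hK : 0 ≤ K) (hε : 0 ≤ ε) :
    gronwallBound δ K ε x ≤ (δ + ε * x) * Real.exp (K * x) := by
  rcases hK.eq_or_lt with rfl | hK
  · simp [gronwallBound_K0]
  · rw [gronwallBound_of_K_ne_0 hK.ne', add_mul]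
    have h1 : Real.exp (K * x) - 1 ≤ K * x * Real.exp (K * x) := by
      have h2 := Real.add_one_le_exp (-(K * x))
      have h3 : Real.exp (-(K * x)) * Real.exp (K * x) = 1 := by rw [← Real.exp_add]; simp
      nlinarith [Real.exp_pos (K * x)]
    have h4 : ε / K * (Real.exp (K * x) - 1) ≤ ε / K * (K * x * Real.exp (K * x)) := by gcongr
    have h5 : ε / K * (K * x * Real.exp (K * x)) = ε * x * Real.exp (K * x) := by field_simp
    linarith

/-- The mean value inequality, applied on a ball contained in the region, compares the perturbed
field with the unperturbed one. -/
theorem norm_lienardField_sub_le (hf : Continuous f) (hg : ContDiff ℝ 1 g) {Λ : ℝ}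
    (hΛ : ∀ x ∈ lienardRegion f r,
      ‖Matrix.toEuclideanCLM (𝕜 := ℝ) (lienardJacobian f g (x 1))‖ ≤ Λ)
    {y x : EuclideanSpace ℝ (Fin 2)} {σ : ℝ} (hσ : ball y σ ⊆ lienardRegion f r) (hx : x ∈ ball y σ)
    (w : ℝ) : ‖lienardField f g w x - lienardField f g 0 y‖ ≤ Λ * ‖x - y‖ + |w| := by
  have h1 : ‖lienardField f g 0 x - lienardField f g 0 y‖ ≤ Λ * ‖x - y‖ :=
    (convex_ball y σ).norm_image_sub_le_of_norm_hasFDerivWithin_le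
      (fun z _ => (hasFDerivAt_lienardField hf hg 0 z).hasFDerivWithinAt)
      (fun z hz => hΛ z (hσ hz)) (mem_ball_self (pos_of_mem_ball hx)) hx
  have h2 : lienardField f g w x - lienardField f g 0 y
      = (lienardField f g 0 x - lienardField f g 0 y) + -(EuclideanSpace.single 0 w) := by
    ext i
    fin_cases i <;> simp [lienardField]
    ring
  rw [h2]
  refine (norm_add_le _ _).trans ?_
  rw [norm_neg, PiLp.norm_single]
  exact add_le_add h1 le_rfl

/-- The solution of the truncated equation stays, by Grönwall's inequality and a first-exit
argument, in a tube around the periodic orbit in which the equation has not been truncated. -/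
theorem exists_solution_of_perturbation_lt (hf : Continuous f) (hg : ContDiff ℝ 1 g)
    (h : SolvesLienardOn f g (fun _ _ _ => 0) u₀ v₀ univ) (hτ₀ : 0 < τ₀)
    (hper : Function.Periodic u₀ τ₀) (horbit : ∀ t, u₀ t ^ 2 + v₀ t ^ 2 < r ^ 2)
    (hγ : ContDiffOn ℝ 2 (fun p : ℝ × ℝ × ℝ => γ p.1 p.2.1 p.2.2)
      (univ ×ˢ {w : ℝ × ℝ | w.1 ^ 2 + w.2 ^ 2 < r ^ 2}))
    (hγper : ∀ s u v, u ^ 2 + v ^ 2 < r ^ 2 → γ (s + 1) u v = γ s u v) {q₀ Λ : ℝ}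
    (hq₀ : ∀ s u v, u ^ 2 + v ^ 2 < r ^ 2 → |γ s u v| ≤ q₀)
    (hΛ : ∀ x ∈ lienardRegion f r,
      ‖Matrix.toEuclideanCLM (𝕜 := ℝ) (lienardJacobian f g (x 1))‖ ≤ Λ)
    {ε φ τ : ℝ} {k : EuclideanSpace ℝ (Fin 2)} (hτ : |τ - τ₀| < τ₀ / 2)
    (hsmall : 3 / 2 * τ₀ * q₀ * |ε| + ‖k‖ <
      distToBoundary f r u₀ v₀ * Real.exp (-(3 / 2 * Λ * τ₀))) :
    ∃ u v : ℝ → ℝ,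
      SolvesLienardOn f g (controlledForcing γ ε τ) u v (Icc φ (φ + τ)) ∧
      (∀ t ∈ Icc φ (φ + τ), u t ^ 2 + v t ^ 2 < r ^ 2) ∧
      lienardPoint f (u φ) (v φ) = lienardPoint f (u₀ 0) (v₀ 0) + k := by
  obtain ⟨hτ1, hτ2⟩ := abs_lt.1 hτ
  have hτpos : 0 < τ := by linarith
  have hΛ0 : 0 ≤ Λ := (norm_nonneg _).trans (hΛ _ (lienardPoint_mem_lienardRegion (horbit 0)))
  have hq₀0 : 0 ≤ q₀ := (abs_nonneg _).trans (hq₀ 0 _ _ (horbit 0))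
  set σ := distToBoundary f r u₀ v₀
  set p : ℝ → EuclideanSpace ℝ (Fin 2) := fun t => lienardPoint f (u₀ t) (v₀ t) with hp
  set δ := (3 / 2 * τ₀ * q₀ * |ε| + ‖k‖) * Real.exp (3 / 2 * Λ * τ₀) with hδ
  have hδσ : δ < σ := by
    rw [Real.exp_neg, ← div_eq_mul_inv, lt_div_iff₀ (Real.exp_pos _)] at hsmall
    exact hsmall
  have hδ0 : 0 ≤ δ := by positivity
  obtain ⟨δ', hδδ', hδ'σ⟩ := exists_between hδσ
  have hball : ∀ t, ball (p t) σ ⊆ lienardRegion f r := ball_distToBoundary_subset horbit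
  have hrange := isCompact_range_lienardPoint hf h hτ₀ hper
  have hQ : IsCompact (cthickening δ' (range p)) := hrange.cthickening
  have hQS : cthickening δ' (range p) ⊆ lienardRegion f r := by
    rw [hrange.cthickening_eq_biUnion_closedBall (hδ0.trans hδδ'.le)]
    refine iUnion₂_subset ?_
    rintro _ ⟨t, rfl⟩
    exact (closedBall_subset_ball hδ'σ).trans (hball t)
  have hW : ContDiffOn ℝ 1 (fun q : ℝ × EuclideanSpace ℝ (Fin 2) =>
      lienardField f g (ε * γ (q.1 / τ) (q.2 1) (lienardVelocity f q.2)) q.2)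
      (univ ×ˢ lienardRegion f r) := by
    refine (contDiff_lienardField hf hg).comp_contDiffOn (ContDiffOn.prodMk
      (contDiffOn_const.mul ?_) contDiffOn_snd)
    exact (contDiffOn_forcing hf hγ).comp
      (f := fun q : ℝ × EuclideanSpace ℝ (Fin 2) => (q.1 / τ, q.2))
      (by fun_prop : ContDiff ℝ 1 _).contDiffOn fun q hq => ⟨trivial, hq.2⟩
  obtain ⟨V, K, O, hVC, hVL, -, -, hQO, -, hVW⟩ := exists_lipschitz_extension_of_periodic
    (W := fun t x => lienardField f g (ε * γ (t / τ) (x 1) (lienardVelocity f x)) x)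
    hτpos (isOpen_lienardRegion hf r) hW (fun t x hx => by
      rw [add_div, div_self hτpos.ne', hγper _ _ _ (mem_lienardRegion.1 hx)]) hQ hQS
  obtain ⟨x, hx0, hx⟩ := exists_forall_hasDerivAt_of_lipschitz hVL (fun y => by
    have := hVC.continuous
    fun_prop) φ (p 0 + k)
  have hxc : Continuous x := continuous_iff_continuousAt.2 fun t => (hx t).continuousAt
  have hpd : ∀ t, HasDerivAt (fun t => p (t - φ)) (lienardField f g 0 (p (t - φ))) t := fun t =>
    (h.hasDerivAt_lienardPoint hf (t := t - φ) trivial).comp_sub_const t φ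
  have hpc : Continuous p := h.continuous_lienardPoint hf
  have hxQ : ∀ t, ‖x t - p (t - φ)‖ < δ' → x t ∈ cthickening δ' (range p) := fun t ht =>
    mem_cthickening_of_dist_le _ _ _ _ (mem_range_self (t - φ)) (by rw [dist_eq_norm]; exact ht.le)
  have hstay : ∀ t ∈ Icc φ (φ + τ), ‖x t - p (t - φ)‖ < δ' := by
    by_contra! hex
    -- the first time at which the solution is at distance `δ'` or more from the orbit
    obtain ⟨t₁, ⟨ht₁, ht₁δ⟩, hmin⟩ := (isCompact_Icc.inter_right (isClosed_le continuous_const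
      (by fun_prop : Continuous fun t => ‖x t - p (t - φ)‖)) :
        IsCompact (Icc φ (φ + τ) ∩ {t | δ' ≤ ‖x t - p (t - φ)‖})).exists_isLeast hex
    have hlt : ∀ t ∈ Ico φ t₁, ‖x t - p (t - φ)‖ < δ' := fun t ht => by
      by_contra! hge
      exact absurd (hmin ⟨⟨ht.1, ht.2.le.trans ht₁.2⟩, hge⟩) (not_le.2 ht.2)
    have key := norm_le_gronwallBound_of_norm_deriv_right_le (f := fun t => x t - p (t - φ))
      (δ := ‖k‖) (K := Λ) (ε := q₀ * |ε|) (a := φ) (b := t₁)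
      (fun t _ => ((hx t).sub (hpd t)).continuousAt.continuousWithinAt)
      (fun t _ => ((hx t).sub (hpd t)).hasDerivWithinAt)
      (by simp [hx0]) (fun t ht => by
        have hxt := hxQ t (hlt t ht)
        rw [hVW t _ (hQO hxt)]
        refine (norm_lienardField_sub_le hf hg hΛ (hball (t - φ))
          (by rw [mem_ball, dist_eq_norm]; exact (hlt t ht).trans hδ'σ) _).trans ?_
        gcongr
        rw [abs_mul, mul_comm]
        gcongr
        exact hq₀ _ _ _ (hQS hxt)) t₁ ⟨ht₁.1, le_rfl⟩
    have hδ2 : gronwallBound ‖k‖ Λ (q₀ * |ε|) (t₁ - φ) ≤ δ := by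
      have ht₁' : t₁ - φ ≤ 3 / 2 * τ₀ := by linarith [ht₁.2]
      have ht₁0 : 0 ≤ t₁ - φ := by linarith [ht₁.1]
      refine (gronwallBound_le hΛ0 (by positivity)).trans ?_
      calc (‖k‖ + q₀ * |ε| * (t₁ - φ)) * Real.exp (Λ * (t₁ - φ))
          ≤ (‖k‖ + q₀ * |ε| * (3 / 2 * τ₀)) * Real.exp (Λ * (3 / 2 * τ₀)) := by gcongr
        _ = δ := by rw [hδ]; ring_nf
    exact absurd (key.trans hδ2) (not_le.2 (hδδ'.trans_le ht₁δ))
  refine ⟨fun t => x t 1, fun t => lienardVelocity f (x t),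
    solvesLienardOn_of_hasDerivAt hf fun t ht => ?_, fun t ht => ?_, ?_⟩
  · have := hx t
    rwa [hVW t _ (hQO (hxQ t (hstay t ht)))] at this
  · exact hQS (hxQ t (hstay t ht))
  · simp only [lienardPoint_velocity, hx0, hp]

end APriori

/-! ### The implicit function theorem and the extended system -/

/-- A form of the implicit function theorem with a continuous implicit function on an open set. -/
theorem exists_continuousOn_implicitFunction {E₁ E₂ F : Type*}
    [NormedAddCommGroup E₁] [NormedSpace ℝ E₁] [CompleteSpace E₁]
    [NormedAddCommGroup E₂] [NormedSpace ℝ E₂] [CompleteSpace E₂]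
    [NormedAddCommGroup F] [NormedSpace ℝ F] [CompleteSpace F]
    {G : E₁ × E₂ → F} {G' : E₁ × E₂ →L[ℝ] F} {q : E₁ × E₂} (hG : HasStrictFDerivAt G G' q)
    (hinv : (G' ∘L .inr ℝ E₁ E₂).IsInvertible) :
    ∃ (U : Set E₁) (ψ : E₁ → E₂), IsOpen U ∧ q.1 ∈ U ∧ ContinuousOn ψ U ∧ ψ q.1 = q.2 ∧
      ∀ x ∈ U, G (x, ψ x) = G q := by
  set Φ := (hG.implicitFunctionDataOfProdDomain hinv).toOpenPartialHomeomorph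
  have hU : IsOpen ((fun x => (G q, x)) ⁻¹' Φ.target) :=
    Φ.open_target.preimage (by fun_prop)
  have hψ : ContinuousOn (hG.implicitFunctionOfProdDomain hinv)
      ((fun x => (G q, x)) ⁻¹' Φ.target) :=
    continuous_snd.comp_continuousOn
      (Φ.continuousOn_symm.comp (by fun_prop : Continuous fun x : E₁ => (G q, x)).continuousOn
        fun x hx => hx)
  obtain ⟨U', hU'G, hU', hqU'⟩ := _root_.eventually_nhds_iff.1
    (hG.eventually_apply_implicitFunctionOfProdDomain hinv)
  refine ⟨_, hG.implicitFunctionOfProdDomain hinv, hU.inter hU', ⟨?_, hqU'⟩,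
    hψ.mono inter_subset_left, ?_, fun x hx => hU'G x hx.2⟩
  · exact (hG.implicitFunctionDataOfProdDomain hinv).map_pt_mem_toOpenPartialHomeomorph_target
  · exact (hG.eventually_apply_eq_iff_implicitFunctionOfProdDomain hinv).self_of_nhds.1 rfl

section ExtendedSystem

/-- The extended phase space: the parameters `(ε, φ)`, the period `τ` and a point of the Liénard
plane. -/
abbrev ExtendedSpace : Type := (ℝ × ℝ) × ℝ × EuclideanSpace ℝ (Fin 2)

/-- The perturbed Liénard system in the rescaled time `s = (t - φ) / τ`, extended by the constant
parameters `ε`, `φ`, `τ`. -/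
noncomputable def extendedField (f g : ℝ → ℝ) (γ : ℝ → ℝ → ℝ → ℝ) (s : ℝ) (z : ExtendedSpace) :
    ExtendedSpace :=
  (0, 0, z.2.1 • lienardField f g
    (z.1.1 * γ (s + z.1.2 / z.2.1) (z.2.2 1) (lienardVelocity f z.2.2)) z.2.2)

variable {f g : ℝ → ℝ} {u₀ v₀ : ℝ → ℝ} {τ₀ r : ℝ} {γ : ℝ → ℝ → ℝ → ℝ}

theorem contDiffOn_extendedField (hf : Continuous f) (hg : ContDiff ℝ 1 g)
    (hγ : ContDiffOn ℝ 2 (fun p : ℝ × ℝ × ℝ => γ p.1 p.2.1 p.2.2)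
      (univ ×ˢ {w : ℝ × ℝ | w.1 ^ 2 + w.2 ^ 2 < r ^ 2})) :
    ContDiffOn ℝ 1 (fun q : ℝ × ExtendedSpace => extendedField f g γ q.1 q.2)
      (univ ×ˢ {z | 0 < z.2.1 ∧ z.2.2 ∈ lienardRegion f r}) := by
  refine contDiffOn_const.prodMk (contDiffOn_const.prodMk (ContDiffOn.smul
    (by fun_prop : ContDiff ℝ 1 fun q : ℝ × ExtendedSpace => q.2.2.1).contDiffOn
    ((contDiff_lienardField hf hg).comp_contDiffOn (ContDiffOn.prodMk
      (ContDiffOn.mul (by fun_prop : ContDiff ℝ 1 fun q : ℝ × ExtendedSpace => q.2.1.1).contDiffOn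
        ?_)
      (by fun_prop : ContDiff ℝ 1 fun q : ℝ × ExtendedSpace => q.2.2.2).contDiffOn))))
  refine (contDiffOn_forcing hf hγ).comp
    (f := fun q : ℝ × ExtendedSpace => (q.1 + q.2.1.2 / q.2.2.1, q.2.2.2)) ?_
    fun q hq => ⟨trivial, hq.2.2⟩
  have hdiv : ContDiffOn ℝ 1 (fun q : ℝ × ExtendedSpace => q.2.1.2 / q.2.2.1)
      (univ ×ˢ {z | 0 < z.2.1 ∧ z.2.2 ∈ lienardRegion f r}) :=
    ContDiffOn.div (by fun_prop : ContDiff ℝ 1 fun q : ℝ × ExtendedSpace => q.2.1.2).contDiffOn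
      (by fun_prop : ContDiff ℝ 1 fun q : ℝ × ExtendedSpace => q.2.2.1).contDiffOn
      fun q hq => hq.2.1.ne'
  exact (contDiffOn_fst.add hdiv).prodMk
    (by fun_prop : ContDiff ℝ 1 fun q : ℝ × ExtendedSpace => q.2.2.2).contDiffOn

/-- The periodic orbit in rescaled time, at the parameters `ε = φ = 0`, `τ = τ₀`. -/
noncomputable def extendedOrbit (f : ℝ → ℝ) (u₀ v₀ : ℝ → ℝ) (τ₀ s : ℝ) : ExtendedSpace :=
  (0, τ₀, lienardPoint f (u₀ (τ₀ * s)) (v₀ (τ₀ * s)))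

theorem SolvesLienardOn.hasDerivAt_extendedOrbit (hf : Continuous f)
    (h : SolvesLienardOn f g (fun _ _ _ => 0) u₀ v₀ univ) (s : ℝ) :
    HasDerivAt (extendedOrbit f u₀ v₀ τ₀)
      (extendedField f g γ s (extendedOrbit f u₀ v₀ τ₀ s)) s := by
  have h1 : HasDerivAt (fun s : ℝ => τ₀ * s) τ₀ s := by
    simpa using (hasDerivAt_id s).const_mul τ₀
  refine ((hasDerivAt_const s _).prodMk ((hasDerivAt_const s _).prodMk
    ((h.hasDerivAt_lienardPoint hf (t := τ₀ * s) trivial).scomp s h1))).congr_deriv ?_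
  simp [extendedField, extendedOrbit]

/-- The derivative of the extended field at the periodic orbit, in the directions of `τ` and of the
Liénard plane. -/
theorem fderiv_extendedField_apply (hf : Continuous f) (hg : ContDiff ℝ 1 g)
    {V : ℝ → ExtendedSpace → ExtendedSpace} {O : Set ExtendedSpace} (hO : IsOpen O)
    (hV : ∀ t, Differentiable ℝ (V t)) (hVW : ∀ t, ∀ x ∈ O, V t x = extendedField f g γ t x)
    {s : ℝ} (hs : extendedOrbit f u₀ v₀ τ₀ s ∈ O) (dτ : ℝ) (y : EuclideanSpace ℝ (Fin 2)) :
    fderiv ℝ (V s) (extendedOrbit f u₀ v₀ τ₀ s) (0, dτ, y) =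
      (0, 0, dτ • lienardField f g 0 (lienardPoint f (u₀ (τ₀ * s)) (v₀ (τ₀ * s))) +
        τ₀ • variationalCLM f g u₀ (τ₀ * s) y) := by
  set x := lienardPoint f (u₀ (τ₀ * s)) (v₀ (τ₀ * s)) with hx
  let ι : ℝ × EuclideanSpace ℝ (Fin 2) →L[ℝ] ExtendedSpace := ContinuousLinearMap.inr ℝ _ _
  have h1 : HasFDerivAt (fun w : ℝ × EuclideanSpace ℝ (Fin 2) => V s (ι w))
      ((fderiv ℝ (V s) (extendedOrbit f u₀ v₀ τ₀ s)).comp ι) (τ₀, x) :=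
    HasFDerivAt.comp (g := V s) (τ₀, x) (hV s (ι (τ₀, x))).hasFDerivAt ι.hasFDerivAt
  have hX : HasFDerivAt (fun w : ℝ × EuclideanSpace ℝ (Fin 2) => lienardField f g 0 w.2)
      ((variationalCLM f g u₀ (τ₀ * s)).comp (ContinuousLinearMap.snd ℝ _ _)) (τ₀, x) :=
    HasFDerivAt.comp (g := lienardField f g 0) (τ₀, x) (hasFDerivAt_lienardField hf hg 0 x)
      hasFDerivAt_snd
  have h2 := (hasFDerivAt_const (0 : ℝ × ℝ) (τ₀, x)).prodMk
    ((hasFDerivAt_const (0 : ℝ) (τ₀, x)).prodMk (hasFDerivAt_fst.smul hX))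
  have hev : (fun w : ℝ × EuclideanSpace ℝ (Fin 2) => V s (ι w)) =ᶠ[𝓝 (τ₀, x)]
      fun w => ((0 : ℝ × ℝ), (0 : ℝ), w.1 • lienardField f g 0 w.2) := by
    filter_upwards [(hO.preimage ι.continuous).mem_nhds hs] with w hw
    rw [hVW s _ hw]
    simp [extendedField, ι]
  have := congrArg (fun M => M (dτ, y)) (h1.unique (h2.congr_of_eventuallyEq hev))
  simpa [ι, add_comm] using this

/-- The variational equation of the extended system along the periodic orbit, solved in the
directions of `τ` and of the Liénard plane. -/
theorem extended_fundamental_solution_apply (hf : Continuous f) (hg : ContDiff ℝ 1 g)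
    (h : SolvesLienardOn f g (fun _ _ _ => 0) u₀ v₀ univ)
    {V : ℝ → ExtendedSpace → ExtendedSpace} {O : Set ExtendedSpace} (hO : IsOpen O)
    (hV : ∀ t, Differentiable ℝ (V t)) (hVW : ∀ t, ∀ x ∈ O, V t x = extendedField f g γ t x)
    (hs : ∀ s, extendedOrbit f u₀ v₀ τ₀ s ∈ O) {K : ℝ≥0} (hVL : ∀ t, LipschitzWith K (V t))
    {L : ℝ → ExtendedSpace →L[ℝ] ExtendedSpace} (hL0 : L 0 = ContinuousLinearMap.id ℝ _)
    (hL : ∀ s, HasDerivAt L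
      ((fderiv ℝ (V s) (extendedOrbit f u₀ v₀ τ₀ s)).comp (L s)) s)
    {Y : ℝ → Matrix (Fin 2) (Fin 2) ℝ}
    (hY : IsFundamentalMatrix (fun t => lienardJacobian f g (u₀ t)) Y)
    (dτ : ℝ) (k : EuclideanSpace ℝ (Fin 2)) (s : ℝ) :
    L s (0, dτ, k) = (0, dτ, Matrix.toEuclideanCLM (𝕜 := ℝ) (Y (τ₀ * s)) k +
      (dτ * s) • lienardField f g 0 (lienardPoint f (u₀ (τ₀ * s)) (v₀ (τ₀ * s)))) := by
  have hB : ∀ s, ‖fderiv ℝ (V s) (extendedOrbit f u₀ v₀ τ₀ s)‖ ≤ K := fun s =>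
    norm_fderiv_le_of_lipschitz ℝ (hVL s)
  refine congrFun (linear_solution_unique hB (y := fun s => L s (0, dτ, k))
    (z := fun s => (0, dτ, Matrix.toEuclideanCLM (𝕜 := ℝ) (Y (τ₀ * s)) k +
      (dτ * s) • lienardField f g 0 (lienardPoint f (u₀ (τ₀ * s)) (v₀ (τ₀ * s)))))
    (fun s => ?_) (fun s => ?_) ?_) s
  · exact ((hL s).clm_apply (hasDerivAt_const s _)).congr_deriv (by simp)
  · have h1 : HasDerivAt (fun s : ℝ => τ₀ * s) τ₀ s := by
      simpa using (hasDerivAt_id s).const_mul τ₀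
    have h2 : HasDerivAt (fun s : ℝ => dτ * s) dτ s := by
      simpa using (hasDerivAt_id s).const_mul dτ
    have h3 := (isFundamentalMatrix_column hY k (τ₀ * s)).scomp s h1
    have h4 := (h.hasDerivAt_lienardField hf hg (τ₀ * s)).scomp s h1
    rw [fderiv_extendedField_apply hf hg hO hV hVW (hs s)]
    refine ((hasDerivAt_const s _).prodMk ((hasDerivAt_const s _).prodMk
      (h3.add (h2.smul h4)))).congr_deriv ?_
    simp only [Function.comp_apply, map_add, map_smul, smul_add, smul_smul, Prod.mk.injEq, true_and]
    rw [mul_comm τ₀ (dτ * s)]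
    abel
  · simp [hL0, hY.1]

end ExtendedSystem

/-! ### Periodic solutions of the perturbed equation -/

section PeriodicSolutions

variable {f g : ℝ → ℝ} {u₀ v₀ : ℝ → ℝ} {τ₀ r : ℝ} {γ : ℝ → ℝ → ℝ → ℝ}

/-- The curve of initial points: displacement `h` of the position, velocity `c(h)`. It is
transversal to `p'(0)`, which is horizontal. -/
theorem exists_hasStrictFDerivAt_initialPoint (hf : Continuous f) {c : ℝ → ℝ} (hc : ContDiff ℝ 1 c)
    (a : ℝ) : ∃ w : EuclideanSpace ℝ (Fin 2), w 1 = 1 ∧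
      HasStrictFDerivAt (fun h : ℝ => lienardPoint f (a + h) (c h))
        (ContinuousLinearMap.toSpanSingleton ℝ w) 0 := by
  have hF := contDiff_primitiveF hf
  have hξ : ContDiff ℝ 1 fun h : ℝ => lienardPoint f (a + h) (c h) := by
    rw [contDiff_euclidean, Fin.forall_fin_two]
    simp only [lienardPoint_zero, lienardPoint_one]
    constructor <;> fun_prop
  have hd := (hξ.differentiable one_ne_zero 0).hasDerivAt
  refine ⟨_, (hasDerivAt_euclidean_fin_two.1 hd).2.unique ?_,
    (hξ.contDiffAt.hasStrictDerivAt one_ne_zero).hasStrictFDerivAt⟩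
  simpa using (hasDerivAt_id (0 : ℝ)).const_add a

/-- Invertibility of the derivative, with respect to `(τ, h)`, of the displacement map. -/
theorem isInvertible_of_monodromy {M : Matrix (Fin 2) (Fin 2) ℝ} (h00 : M 0 0 = 1) (h10 : M 1 0 = 0)
    (h11 : M 1 1 ≠ 1) {w q : EuclideanSpace ℝ (Fin 2)} (hw : w 1 = 1) (hq0 : q 0 ≠ 0)
    (hq1 : q 1 = 0)
    {A : ℝ × ℝ →L[ℝ] EuclideanSpace ℝ (Fin 2)}
    (hA : ∀ d, A d = Matrix.toEuclideanCLM (𝕜 := ℝ) M (d.2 • w) + d.1 • q - d.2 • w) :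
    A.IsInvertible := by
  have hinj : Function.Injective A := by
    refine (injective_iff_map_eq_zero A).2 fun d hd => ?_
    rw [hA] at hd
    have e0 := congrArg (fun y : EuclideanSpace ℝ (Fin 2) => y 0) hd
    have e1 := congrArg (fun y : EuclideanSpace ℝ (Fin 2) => y 1) hd
    simp [Matrix.mulVec, dotProduct, Fin.sum_univ_two, h00, h10, hw, hq1] at e0 e1
    have h2 : d.2 = 0 := by
      have : (M 1 1 - 1) * d.2 = 0 := by linarith
      exact (mul_eq_zero.1 this).resolve_left (sub_ne_zero.2 h11)
    rw [h2] at e0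
    simp [hq0] at e0
    exact Prod.ext e0 h2
  exact ⟨(LinearEquiv.ofInjectiveOfFinrankEq A.toLinearMap hinj
    (by simp)).toContinuousLinearEquiv, by ext <;> rfl⟩

/-- An orbit of the extended system over the unit time interval that closes up in the Liénard plane
gives a periodic solution of the perturbed equation. -/
theorem exists_solution_of_closed_orbit (hf : Continuous f)
    {V : ℝ → ExtendedSpace → ExtendedSpace} {K : ℝ≥0} (hVL : ∀ t, LipschitzWith K (V t))
    (hVper : ∀ t x, V (t + 1) x = V t x) {O : Set ExtendedSpace}
    (hOΩ : O ⊆ {z | 0 < z.2.1 ∧ z.2.2 ∈ lienardRegion f r})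
    (hVW : ∀ t, ∀ x ∈ O, V t x = extendedField f g γ t x) {y : ℝ → ExtendedSpace}
    (hy : ∀ s, HasDerivAt y (V s (y s)) s) (hyO : ∀ s ∈ Icc (0 : ℝ) 1, y s ∈ O)
    (hclosed : (y 1).2.2 = (y 0).2.2) :
    ∃ u v : ℝ → ℝ, SolvesLienardOn f g (controlledForcing γ (y 0).1.1 (y 0).2.1) u v univ ∧
      (∀ t, u t ^ 2 + v t ^ 2 < r ^ 2) ∧ u (y 0).1.2 = (y 0).2.2 1 ∧
      v (y 0).1.2 = lienardVelocity f (y 0).2.2 ∧ Function.Periodic u (y 0).2.1 := by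
  have hyc : Continuous y := continuous_iff_continuousAt.2 fun s => (hy s).continuousAt
  -- the parameters do not change along the orbit
  have hconst : ∀ s ∈ Icc (0 : ℝ) 1, ((y s).1, (y s).2.1) = ((y 0).1, (y 0).2.1) := by
    refine constant_of_has_deriv_right_zero (f := fun s => ((y s).1, (y s).2.1))
      (by fun_prop) fun s hs => ?_
    have h1 := hy s
    rw [hVW s _ (hyO s (Ico_subset_Icc_self hs))] at h1
    have h2 : HasDerivAt (fun s => ((y s).1, (y s).2.1)) _ s :=
      ((ContinuousLinearMap.fst ℝ (ℝ × ℝ) (ℝ × EuclideanSpace ℝ (Fin 2))).prod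
        ((ContinuousLinearMap.fst ℝ ℝ (EuclideanSpace ℝ (Fin 2))).comp
          (ContinuousLinearMap.snd ℝ (ℝ × ℝ) _))).hasFDerivAt.comp_hasDerivAt s h1
    exact (h2.congr_deriv (by simp [extendedField])).hasDerivWithinAt
  have hper : Function.Periodic y 1 := by
    refine congrFun (ODE_solution_unique_univ (s := fun _ => univ) (K := K) (t₀ := 0)
      (fun t => (hVL t).lipschitzOnWith) (f := fun s => y (s + 1)) (g := y)
      (fun s => ⟨?_, trivial⟩) (fun s => ⟨hy s, trivial⟩) ?_)
    · rw [← hVper]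
      exact (hy (s + 1)).comp_add_const s 1
    · have := hconst 1 ⟨zero_le_one, le_rfl⟩
      rw [Prod.mk.injEq] at this
      rw [zero_add]
      exact Prod.ext this.1 (Prod.ext this.2 hclosed)
  have hall : ∀ s, y s ∈ O ∧ (y s).1 = (y 0).1 ∧ (y s).2.1 = (y 0).2.1 := fun s => by
    obtain ⟨s', hs', hss'⟩ := hper.exists_mem_Ico₀ one_pos s
    rw [hss']
    exact ⟨hyO s' (Ico_subset_Icc_self hs'), Prod.mk.inj (hconst s' (Ico_subset_Icc_self hs'))⟩
  set ε := (y 0).1.1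
  set φ := (y 0).1.2 with hφ
  set τ := (y 0).2.1 with hτ
  have hτ0 : 0 < τ := (hOΩ (hall 0).1).1
  have hx : ∀ t, HasDerivAt (fun t => (y ((t - φ) / τ)).2.2)
      (lienardField f g (controlledForcing γ ε τ t ((y ((t - φ) / τ)).2.2 1)
        (lienardVelocity f (y ((t - φ) / τ)).2.2)) (y ((t - φ) / τ)).2.2) t := fun t => by
    have h1 : HasDerivAt (fun t : ℝ => (t - φ) / τ) (1 / τ) t :=
      ((hasDerivAt_id t).sub_const φ).div_const τ
    obtain ⟨hO, hp, hq⟩ := hall ((t - φ) / τ)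
    have h2 := (hy ((t - φ) / τ)).scomp t h1
    rw [hVW _ _ hO] at h2
    have h3 : HasDerivAt (fun t => (y ((t - φ) / τ)).2.2) _ t :=
      ((ContinuousLinearMap.snd ℝ ℝ (EuclideanSpace ℝ (Fin 2))).comp
        (ContinuousLinearMap.snd ℝ (ℝ × ℝ) _)).hasFDerivAt.comp_hasDerivAt t h2
    refine h3.congr_deriv ?_
    have hs : (t - φ) / τ + φ / τ = t / τ := by rw [← add_div, sub_add_cancel]
    simp only [extendedField, hp, hq, ← hφ, ContinuousLinearMap.comp_apply,
      ContinuousLinearMap.coe_snd', Prod.smul_snd, smul_smul, hs]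
    rw [one_div, inv_mul_cancel₀ hτ0.ne', one_smul]
    rfl
  refine ⟨fun t => (y ((t - φ) / τ)).2.2 1, fun t => lienardVelocity f (y ((t - φ) / τ)).2.2,
    solvesLienardOn_of_hasDerivAt hf fun t _ => hx t, fun t => (hOΩ (hall _).1).2, by simp,
    by simp, fun t => ?_⟩
  have : (t + τ - φ) / τ = (t - φ) / τ + 1 := by field_simp; ring
  simp only [this, hper _]

/-- If `1` is a simple characteristic multiplier, the displacement map of the extended flow can be
solved for `(τ, h)` by the implicit function theorem. -/
theorem exists_periodic_solutions (hf : Continuous f) (hg : ContDiff ℝ 1 g)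
    (h : SolvesLienardOn f g (fun _ _ _ => 0) u₀ v₀ univ) (hτ₀ : 0 < τ₀)
    (hper : Function.Periodic u₀ τ₀) (hnonconst : ∃ t, u₀ t ≠ u₀ 0) (hv0 : v₀ 0 = 0)
    (horbit : ∀ t, u₀ t ^ 2 + v₀ t ^ 2 < r ^ 2)
    (hγ : ContDiffOn ℝ 2 (fun p : ℝ × ℝ × ℝ => γ p.1 p.2.1 p.2.2)
      (univ ×ˢ {w : ℝ × ℝ | w.1 ^ 2 + w.2 ^ 2 < r ^ 2}))
    (hγper : ∀ s u v, u ^ 2 + v ^ 2 < r ^ 2 → γ (s + 1) u v = γ s u v)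
    (hne : (∫ t in (0 : ℝ)..τ₀, f (u₀ t)) ≠ 0) {c : ℝ → ℝ} (hc : ContDiff ℝ 1 c) (hc0 : c 0 = 0)
    {τ₁ : ℝ} (hτ₁ : 0 < τ₁) :
    ∃ (U : Set (ℝ × ℝ)) (τ h : ℝ × ℝ → ℝ), IsOpen U ∧ (0 : ℝ × ℝ) ∈ U ∧ ContinuousOn τ U ∧
      ContinuousOn h U ∧ τ 0 = τ₀ ∧ h 0 = 0 ∧
      ∀ b ∈ U, |b.2| < τ₀ / 2 ∧ |τ b - τ₀| < τ₁ ∧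
        ∃ u v : ℝ → ℝ, SolvesLienardOn f g (controlledForcing γ b.1 (τ b)) u v univ ∧
          (∀ t, u t ^ 2 + v t ^ 2 < r ^ 2) ∧ u b.2 = u₀ 0 + h b ∧ v b.2 = c (h b) ∧
          Function.Periodic u (τ b) := by
  -- the globally Lipschitz extended field and its flow
  set zb := extendedOrbit f u₀ v₀ τ₀ with hzb
  have hzbc : Continuous zb := continuous_iff_continuousAt.2 fun s =>
    (h.hasDerivAt_extendedOrbit (γ := γ) hf s).continuousAt
  have hscale : ∀ s : ℝ, τ₀ * (s + 1) = τ₀ * s + τ₀ := fun s => by ring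
  have hzbper : Function.Periodic zb 1 := fun s => by
    simp only [hzb, extendedOrbit, hscale, hper _, h.periodic_velocity hper _]
  have hQ : IsCompact (range zb) := by
    rw [← hzbper.image_Icc one_pos 0]
    exact isCompact_Icc.image hzbc
  have hΩ : IsOpen {z : ExtendedSpace | 0 < z.2.1 ∧ z.2.2 ∈ lienardRegion f r} :=
    (isOpen_lt continuous_const (by fun_prop : Continuous fun z : ExtendedSpace => z.2.1)).inter
      ((isOpen_lienardRegion hf r).preimage
        (by fun_prop : Continuous fun z : ExtendedSpace => z.2.2))
  obtain ⟨V, K, O, hVC, hVL, hVper, hO, hQO, hOΩ, hVW⟩ := exists_lipschitz_extension_of_periodic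
    one_pos hΩ (contDiffOn_extendedField hf hg hγ) (fun s z hz => by
      simp only [extendedField]
      rw [add_right_comm, hγper _ _ _ (mem_lienardRegion.1 hz.2)]) hQ
    (by rintro _ ⟨s, rfl⟩; exact ⟨hτ₀, lienardPoint_mem_lienardRegion (horbit _)⟩)
  have hzbO : ∀ s, zb s ∈ O := fun s => hQO (mem_range_self s)
  have hVcont : ∀ y, Continuous fun t => V t y := fun y => by
    have := hVC.continuous
    fun_prop
  choose z hz0 hz using exists_forall_hasDerivAt_of_lipschitz hVL hVcont 0
  have hzζ : z (zb 0) = zb :=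
    ODE_solution_unique_univ (s := fun _ => univ) (t₀ := 0) (fun t => (hVL t).lipschitzOnWith)
      (fun t => ⟨hz _ t, trivial⟩)
      (fun t => ⟨by
        rw [hVW t _ (hzbO t)]; exact h.hasDerivAt_extendedOrbit hf t, trivial⟩) (hz0 _)
  -- the derivative of the time-one map
  obtain ⟨L, hL0, hL⟩ := exists_fundamental_solution
    (B := fun s => fderiv ℝ (V s) (zb s)) (K := K)
    (fun s => norm_fderiv_le_of_lipschitz ℝ (hVL s))
    (hVC.continuous_fderiv_slice.comp (continuous_id.prodMk hzbc))
  have hflow : HasStrictFDerivAt (fun x => z x 1) (L 1) (zb 0) :=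
    hasStrictFDerivAt_flow hVC hVL hz0 hz (zb 0) hL0 (by rw [hzζ]; exact hL) zero_le_one
  obtain ⟨Y, hY⟩ := exists_isFundamentalMatrix hf hg h.continuous_position hτ₀ hper
  have hLapp : ∀ dτ k, L 1 (0, dτ, k) = (0, dτ, Matrix.toEuclideanCLM (𝕜 := ℝ) (Y τ₀) k +
      dτ • lienardField f g 0 (lienardPoint f (u₀ 0) (v₀ 0))) := fun dτ k => by
    rw [extended_fundamental_solution_apply hf hg h hO hVC.differentiable_slice hVW hzbO hVL hL0 hL
      hY dτ k 1]
    have e1 : u₀ τ₀ = u₀ 0 := by simpa using hper 0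
    have e2 : v₀ τ₀ = v₀ 0 := by simpa using h.periodic_velocity hper 0
    simp only [mul_one, e1, e2]
  -- the displacement map and the implicit function theorem
  obtain ⟨w, hw1, hξ⟩ := exists_hasStrictFDerivAt_initialPoint hf hc (u₀ 0)
  set ξ : ℝ → EuclideanSpace ℝ (Fin 2) := fun h => lienardPoint f (u₀ 0 + h) (c h) with hξdef
  let j : (ℝ × ℝ) × (ℝ × ℝ) → ExtendedSpace := fun q => (q.1, q.2.1, ξ q.2.2)
  let q₀ : (ℝ × ℝ) × (ℝ × ℝ) := (0, τ₀, 0)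
  have hjq : j q₀ = zb 0 := by simp [j, q₀, hzb, hξdef, extendedOrbit, hc0, hv0]
  have hξq : HasStrictFDerivAt (fun q : (ℝ × ℝ) × (ℝ × ℝ) => ξ q.2.2)
      ((ContinuousLinearMap.toSpanSingleton ℝ w).comp
        ((ContinuousLinearMap.snd ℝ ℝ ℝ).comp (ContinuousLinearMap.snd ℝ (ℝ × ℝ) (ℝ × ℝ)))) q₀ :=
    HasStrictFDerivAt.comp (g := ξ) q₀ hξ
      (ContinuousLinearMap.hasStrictFDerivAt
        ((ContinuousLinearMap.snd ℝ ℝ ℝ).comp (ContinuousLinearMap.snd ℝ (ℝ × ℝ) (ℝ × ℝ))))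
  have hj : HasStrictFDerivAt j _ q₀ := hasStrictFDerivAt_fst.prodMk
    (((ContinuousLinearMap.fst ℝ ℝ ℝ).comp
      (ContinuousLinearMap.snd ℝ (ℝ × ℝ) (ℝ × ℝ))).hasStrictFDerivAt.prodMk hξq)
  let π : ExtendedSpace →L[ℝ] EuclideanSpace ℝ (Fin 2) :=
    (ContinuousLinearMap.snd ℝ ℝ _).comp (ContinuousLinearMap.snd ℝ (ℝ × ℝ) _)
  obtain ⟨G', hG', hG⟩ : ∃ G' : (ℝ × ℝ) × (ℝ × ℝ) →L[ℝ] EuclideanSpace ℝ (Fin 2),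
      (∀ d, G' (0, d) = Matrix.toEuclideanCLM (𝕜 := ℝ) (Y τ₀) (d.2 • w) +
        d.1 • lienardField f g 0 (lienardPoint f (u₀ 0) (v₀ 0)) - d.2 • w) ∧
      HasStrictFDerivAt (fun q => π (z (j q) 1) - ξ q.2.2) G' q₀ := by
    refine ⟨_, fun d => ?_, (π.hasStrictFDerivAt.comp q₀
      (HasStrictFDerivAt.comp (g := fun x => z x 1) q₀ (by rw [hjq]; exact hflow) hj)).sub hξq⟩
    simp [π, hLapp]
  have hg0 := h.force_ne_zero hf hg hτ₀ hper hnonconst hv0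
  obtain ⟨h00, h10, h11⟩ := monodromy_entries hf hg h hτ₀ hper hnonconst hv0 hY
  have hinv := isInvertible_of_monodromy h00 h10
    (by rw [h11]; simpa [Real.exp_eq_one_iff] using hne) hw1
    (q := lienardField f g 0 (lienardPoint f (u₀ 0) (v₀ 0)))
    (by simpa [lienardField] using hg0) (by simp [lienardField, hv0])
    (A := G' ∘L .inr ℝ (ℝ × ℝ) (ℝ × ℝ)) (fun d => by simpa using hG' d)
  obtain ⟨U, ψ, hU, h0U, hψ, hψ0, hψG⟩ := exists_continuousOn_implicitFunction hG hinv
  have hGq : π (z (j q₀) 1) - ξ q₀.2.2 = 0 := by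
    rw [hjq, hzζ, show zb 1 = zb 0 by simpa using hzbper 0, ← hjq]
    simp [π, j]
  -- near the base point the solutions stay, over one period, where the field was not changed
  obtain ⟨δ, hδ, hδO⟩ := hQ.exists_thickening_subset_open hO hQO
  have hstay : ∀ ζ ∈ ball (zb 0) (δ * Real.exp (-K)), ∀ s ∈ Icc (0 : ℝ) 1, z ζ s ∈ O := by
    intro ζ hζ s hs
    refine hδO (mem_thickening_iff.2 ⟨zb s, mem_range_self s, ?_⟩)
    rw [mem_ball, dist_eq_norm] at hζ
    rw [dist_eq_norm]
    calc ‖z ζ s - zb s‖ ≤ ‖ζ - zb 0‖ * Real.exp (K * s) := by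
          have := norm_sub_le_of_lipschitz hVL (hz ζ) (hz (zb 0)) hs.1
          rwa [hz0, hz0, hzζ] at this
      _ ≤ ‖ζ - zb 0‖ * Real.exp K := by
          gcongr
          exact mul_le_of_le_one_right K.2 hs.2
      _ < δ * Real.exp (-K) * Real.exp K := by gcongr
      _ = δ := by rw [mul_assoc, ← Real.exp_add]; simp
  have hξc : Continuous ξ := by
    have h1 := (contDiff_primitiveF hf).continuous
    have h2 := hc.continuous
    refine (PiLp.continuous_toLp 2 _).comp (continuous_pi fun i => ?_)
    fin_cases i <;> simp <;> fun_prop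
  have hjc : Continuous j := by fun_prop
  let N : Set ((ℝ × ℝ) × (ℝ × ℝ)) :=
    {q | |q.1.2| < τ₀ / 2 ∧ |q.2.1 - τ₀| < τ₁ ∧ j q ∈ ball (zb 0) (δ * Real.exp (-K))}
  have hN : IsOpen N :=
    (isOpen_lt (by fun_prop : Continuous fun q : (ℝ × ℝ) × (ℝ × ℝ) => |q.1.2|)
      continuous_const).inter
    ((isOpen_lt (by fun_prop : Continuous fun q : (ℝ × ℝ) × (ℝ × ℝ) => |q.2.1 - τ₀|)
      continuous_const).inter (isOpen_ball.preimage hjc))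
  refine ⟨U ∩ (fun b => (b, ψ b)) ⁻¹' N, fun b => (ψ b).1, fun b => (ψ b).2,
    (continuousOn_id.prodMk hψ).isOpen_inter_preimage hU hN, ⟨h0U, ?_⟩,
    (continuous_fst.comp_continuousOn hψ).mono inter_subset_left,
    (continuous_snd.comp_continuousOn hψ).mono inter_subset_left, ?_, ?_, ?_⟩
  · have : ((0 : ℝ × ℝ), ψ 0) = q₀ := Prod.ext rfl hψ0
    rw [mem_preimage, this]
    refine ⟨by simpa [q₀] using hτ₀, by simpa [q₀] using hτ₁, ?_⟩
    rw [hjq]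
    exact mem_ball_self (by positivity)
  · exact congrArg Prod.fst hψ0
  · exact congrArg Prod.snd hψ0
  · rintro b ⟨hbU, hbN⟩
    refine ⟨hbN.1, hbN.2.1, ?_⟩
    have hclosed : (z (j (b, ψ b)) 1).2.2 = (z (j (b, ψ b)) 0).2.2 := by
      have := (hψG b hbU).trans hGq
      rw [hz0]
      exact sub_eq_zero.1 this
    obtain ⟨u, v, h1, h2, h3, h4, h5⟩ := exists_solution_of_closed_orbit hf hVL hVper hOΩ hVW
      (hz (j (b, ψ b))) (hstay _ hbN.2.2) hclosed
    rw [hz0] at h1 h3 h4 h5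
    exact ⟨u, v, h1, h2, by simpa [j, hξdef] using h3, by simpa [j, hξdef] using h4, h5⟩

end PeriodicSolutions

end

theorem theorem1
    (f g : ℝ → ℝ) (hf : ContDiff ℝ 2 f) (hg : ContDiff ℝ 2 g)
    (hf_even : ∀ x, f (-x) = f x) (hg_odd : ∀ x, g (-x) = -g x)
    -- the non-constant `τ₀`-periodic solution of the unperturbed equation, with `u₀'(0) = 0`
    (u₀ v₀ : ℝ → ℝ) (τ₀ a r : ℝ) (hτ₀ : 0 < τ₀)
    (hu₀ : SolvesLienardOn f g (fun _ _ _ => 0) u₀ v₀ Set.univ)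
    (hper : Function.Periodic u₀ τ₀) (hnonconst : ∃ t, u₀ t ≠ u₀ 0)
    (hua : u₀ 0 = a) (hv0 : v₀ 0 = 0)
    (horbit : ∀ t, u₀ t ^ 2 + v₀ t ^ 2 < r ^ 2)
    -- the perturbation: `C²` and `1`-periodic in `s = t / τ`
    (γ : ℝ → ℝ → ℝ → ℝ)
    (hγ : ContDiffOn ℝ 2 (fun p : ℝ × ℝ × ℝ => γ p.1 p.2.1 p.2.2)
      (Set.univ ×ˢ {w : ℝ × ℝ | w.1 ^ 2 + w.2 ^ 2 < r ^ 2}))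
    (hγper : ∀ s u v, u ^ 2 + v ^ 2 < r ^ 2 → γ (s + 1) u v = γ s u v) :
    -- what simplicity of the multiplier `1` of the variational system means
    (IsSimpleCharMultiplier (fun t => lienardJacobian f g (u₀ t)) τ₀ 1 ↔
      (∫ t in (0 : ℝ)..τ₀, f (u₀ t)) ≠ 0) ∧
    -- existence of the periodic solutions of the perturbed equation; `c` prescribes the initial
    -- velocity that goes with the displacement `h` of the initial position
    (IsSimpleCharMultiplier (fun t => lienardJacobian f g (u₀ t)) τ₀ 1 →
      ∀ c : ℝ → ℝ, ContDiff ℝ 1 c → c 0 = 0 →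
      ∃ (τ₁ : ℝ) (U : Set (ℝ × ℝ)) (τ h : ℝ → ℝ → ℝ),
        0 < τ₁ ∧ τ₁ < τ₀ / 2 ∧ IsOpen U ∧ ((0 : ℝ), (0 : ℝ)) ∈ U ∧
        ContinuousOn (fun p : ℝ × ℝ => τ p.1 p.2) U ∧
        ContinuousOn (fun p : ℝ × ℝ => h p.1 p.2) U ∧
        τ 0 0 = τ₀ ∧ h 0 0 = 0 ∧
        ∀ ε φ : ℝ, (ε, φ) ∈ U →
          |φ| < τ₀ / 2 ∧ |τ ε φ - τ₀| < τ₁ ∧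
          ∃ u v : ℝ → ℝ,
            SolvesLienardOn f g (controlledForcing γ ε (τ ε φ)) u v Set.univ ∧
            (∀ t, u t ^ 2 + v t ^ 2 < r ^ 2) ∧
            u φ = a + h ε φ ∧ v φ = c (h ε φ) ∧
            Function.Periodic u (τ ε φ)) ∧
    -- explicit region of `ε`, `φ`, `τ` and of the displacement `k` (a vector of the Liénard plane)
    -- in which the solution exists over one period and stays in the region
    (0 < distToBoundary f r u₀ v₀ ∧
      ∀ q₀ Λ : ℝ,
      (∀ s u v, u ^ 2 + v ^ 2 < r ^ 2 → |γ s u v| ≤ q₀) →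
      (∀ x ∈ lienardRegion f r,
        ‖Matrix.toEuclideanCLM (𝕜 := ℝ) (lienardJacobian f g (x 1))‖ ≤ Λ) →
      ∀ (ε φ τ : ℝ) (k : EuclideanSpace ℝ (Fin 2)),
        |φ| < τ₀ / 2 → |τ - τ₀| < τ₀ / 2 →
        3 / 2 * τ₀ * q₀ * |ε| + ‖k‖ <
          distToBoundary f r u₀ v₀ * Real.exp (-(3 / 2 * Λ * τ₀)) →
        ∃ u v : ℝ → ℝ,
          SolvesLienardOn f g (controlledForcing γ ε τ) u v (Set.Icc φ (φ + τ)) ∧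
          (∀ t ∈ Set.Icc φ (φ + τ), u t ^ 2 + v t ^ 2 < r ^ 2) ∧
          lienardPoint f (u φ) (v φ) = lienardPoint f a 0 + k) := by
  have hf1 : Continuous f := hf.continuous
  have hg1 : ContDiff ℝ 1 g := hg.of_le one_le_two
  subst hua
  have hsimple := isSimpleCharMultiplier_iff hf1 hg1 hu₀ hτ₀ hper hnonconst hv0
  refine ⟨hsimple, fun hmult c hc hc0 => ?_, distToBoundary_pos hf1 hu₀ hτ₀ hper horbit,
    fun q₀ Λ hq₀ hΛ ε φ τ k _ hτ hsmall => ?_⟩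
  · obtain ⟨U, τ, h, hU, h0U, hτc, hhc, hτ0, hh0, hsol⟩ := exists_periodic_solutions hf1 hg1 hu₀ hτ₀
      hper hnonconst hv0 horbit hγ hγper (hsimple.1 hmult) hc hc0
      (τ₁ := τ₀ / 4) (by linarith)
    exact ⟨τ₀ / 4, U, fun ε φ => τ (ε, φ), fun ε φ => h (ε, φ), by linarith, by linarith, hU, h0U,
      hτc, hhc, hτ0, hh0, fun ε φ hb => hsol (ε, φ) hb⟩
  · obtain ⟨u, v, h1, h2, h3⟩ := exists_solution_of_perturbation_lt hf1 hg1 hu₀ hτ₀ hper horbit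
      hγ hγper hq₀ hΛ hτ hsmall
    exact ⟨u, v, h1, h2, by rw [h3, hv0]⟩
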